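/- For a local ring $R$ let $W(R)$ be the Witt ring of unimodular symmetric bilinear forms on finitely generated free $R$-modules modulo metabolic forms, $IR\subset W(R)$ the fundamental ideal generated by the classes of the forms of even rank, and $I^mR=(IR)^m$. Let $W_q(R)$ be the Witt group of nonsingular quadratic forms over $R$, that is, of quadratic forms on finitely generated free $R$-modules whose polar form is unimodular, modulo hyperbolic forms; it is a module over $W(R)$ through the tensor product of a symmetric bilinear form with a quadratic form. Write $I^mR\otimes W_q(R)$ for the submodule $I^mR\cdot W_q(R)$ of $W_q(R)$. A nonsingular quadratic form over $R$ is said to have Witt class in $I^mR$ if the class of its polar form in $W(R)$ lies in $I^mR$. Let $A$ be a Henselian discrete valuation ring of characteristic $0$ with maximal ideal $2A$ and residue field $F=A/2A$. Let $n\ge 1$ and let $\psi$ be a nonsingular quadratic form over $F$ whose Witt class is in $I^nF\otimes W_q(F)$. Then there is a nonsingular quadratic form $\psi'$ over $A$ whose Witt class is in $I^{n+1}A$ and whose reduction $\overline{\psi'}$ modulo $2$ is Witt equivalent to $\psi$, i.e. has the same class as $\psi$ in $W_q(F)$. Moreover, if $n=1$, then $\psi'$ can be chosen such that $\overline{\psi'}$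 is isometric to $\psi$. -/

import Mathlib

open scoped TensorProduct

universe u

noncomputable section

/-- A (unimodular) symmetric bilinear space over `R`: a finitely generated free module with a
symmetric bilinear form whose adjoint map to the dual module is bijective. -/
structure BilinSpace (R : Type u) [CommRing R] : Type (u + 1) where
  carrier : Type u
  [addCommGroup : AddCommGroup carrier]
  [module : Module R carrier]
  [free : Module.Free R carrier]
  [finite : Module.Finite R carrier]
  form : LinearMap.BilinForm R carrier
  symm : form.IsSymm
  unimodular : Function.Bijective form

namespace BilinSpace

attribute [instance] addCommGroup module free finite

variable {R : Type u} [CommRing R]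

/-- Isometry of symmetric bilinear spaces. -/
def Isometric (V W : BilinSpace R) : Prop := V.form.Equivalent W.form

lemma isometric_of {V W : BilinSpace R} (e : V.carrier ≃ₗ[R] W.carrier)
    (h : W.form.compl₁₂ e.toLinearMap e.toLinearMap = V.form) : V.Isometric W :=
  ⟨{ e with map_app' := fun x y => LinearMap.congr_fun₂ h x y }⟩

lemma Isometric.exists_equiv {V W : BilinSpace R} (h : V.Isometric W) :
    ∃ e : V.carrier ≃ₗ[R] W.carrier, W.form.compl₁₂ e.toLinearMap e.toLinearMap = V.form := by
  obtain ⟨e⟩ := h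
  exact ⟨e.toLinearEquiv, by ext x y; exact e.map_app' x y⟩

/-- Isometry as a setoid. -/
instance setoid (R : Type u) [CommRing R] : Setoid (BilinSpace R) where
  r := Isometric
  iseqv := ⟨fun V => .refl V.form, fun h => h.symm, fun h h' => h.trans h'⟩

/-- The zero space. -/
abbrev zero (R : Type u) [CommRing R] : BilinSpace R where
  carrier := PUnit
  form := 0
  symm := ⟨fun _ _ => rfl⟩
  unimodular := ⟨fun _ _ _ => rfl, fun f => ⟨0, LinearMap.ext fun _ => (map_zero f).symm⟩⟩

/-- The space `⟨1⟩`. -/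
abbrev one (R : Type u) [CommRing R] : BilinSpace R where
  carrier := R
  form := LinearMap.mul R R
  symm := ⟨fun x y => mul_comm x y⟩
  unimodular := ⟨fun x y h => by simpa using LinearMap.congr_fun h 1,
    fun f => ⟨f 1, by ext; simp⟩⟩

/-- Orthogonal sum. -/
abbrev add (V W : BilinSpace R) : BilinSpace R where
  carrier := V.carrier × W.carrier
  form := V.form.compl₁₂ (.fst R _ _) (.fst R _ _) + W.form.compl₁₂ (.snd R _ _) (.snd R _ _)
  symm := ⟨fun x y => by simp [V.symm.eq x.1 y.1, W.symm.eq x.2 y.2]⟩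
  unimodular := by
    constructor
    · intro x y h
      refine Prod.ext (V.unimodular.1 ?_) (W.unimodular.1 ?_)
      · ext v; simpa using LinearMap.congr_fun h (v, 0)
      · ext w; simpa using LinearMap.congr_fun h (0, w)
    · intro f
      obtain ⟨v, hv⟩ := V.unimodular.2 (f ∘ₗ .inl R _ _)
      obtain ⟨w, hw⟩ := W.unimodular.2 (f ∘ₗ .inr R _ _)
      exact ⟨(v, w), by ext <;> simp [hv, hw, Prod.mk_zero_zero]⟩

lemma bijective_tmul {V W : Type u} [AddCommGroup V] [Module R V] [Module.Free R V]
    [Module.Finite R V] [AddCommGroup W] [Module R W] [Module.Free R W] [Module.Finite R W]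
    (b : LinearMap.BilinForm R V) (c : LinearMap.BilinForm R W)
    (hb : Function.Bijective b) (hc : Function.Bijective c) :
    Function.Bijective (LinearMap.BilinForm.tmul b c) := by
  have h : (LinearMap.BilinForm.tmul b c : V ⊗[R] W →ₗ[R] V ⊗[R] W →ₗ[R] R) =
      ((TensorProduct.congr (.ofBijective b hb) (.ofBijective c hc)) ≪≫ₗ
        TensorProduct.dualDistribEquiv R V W).toLinearMap := by
    ext v w v' w'
    simp [TensorProduct.dualDistribEquiv, TensorProduct.dualDistribEquivOfBasis, mul_comm]
  rw [h]
  exact LinearEquiv.bijective _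

/-- Tensor product, with `(b ⊗ c)(v ⊗ w, v' ⊗ w') = b(v, v') c(w, w')`. -/
abbrev mul (V W : BilinSpace R) : BilinSpace R where
  carrier := V.carrier ⊗[R] W.carrier
  form := LinearMap.BilinForm.tmul V.form W.form
  symm := by
    refine ⟨fun x y => ?_⟩
    have h : LinearMap.BilinForm.tmul V.form W.form =
        (LinearMap.BilinForm.tmul V.form W.form).flip := by
      ext x₁ x₂ y₁ y₂
      exact congr_arg₂ (HSMul.hSMul) (W.symm.eq x₂ y₂) (V.symm.eq x₁ y₁)
    exact LinearMap.congr_fun₂ h x y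
  unimodular := bijective_tmul _ _ V.unimodular W.unimodular

/-- The space with the form multiplied by `-1`. -/
abbrev neg (V : BilinSpace R) : BilinSpace R where
  carrier := V.carrier
  form := -V.form
  symm := ⟨fun x y => by simp [V.symm.eq x y]⟩
  unimodular := by
    have : ⇑(-V.form) = (LinearEquiv.neg R : (V.carrier →ₗ[R] R) ≃ₗ[R] _) ∘ V.form := rfl
    rw [this]
    exact (LinearEquiv.bijective _).comp V.unimodular

/-- A direct summand which equals its own orthogonal. -/
def IsLagrangian (V : BilinSpace R) (N : Submodule R V.carrier) : Prop :=
  (∃ N', IsCompl N N') ∧ V.form.orthogonal N = N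

/-- A space is metabolic if it has a direct summand which equals its own orthogonal. -/
def IsMetabolic (V : BilinSpace R) : Prop :=
  ∃ N : Submodule R V.carrier, V.IsLagrangian N

lemma add_congr {V V' W W' : BilinSpace R} (h : V.Isometric V') (h' : W.Isometric W') :
    (V.add W).Isometric (V'.add W') := by
  obtain ⟨e, he⟩ := h.exists_equiv
  obtain ⟨f, hf⟩ := h'.exists_equiv
  refine isometric_of (e.prodCongr f) ?_
  change _ = V.form.compl₁₂ _ _ + W.form.compl₁₂ _ _
  rw [← he, ← hf]
  ext <;> simp [add]

lemma mul_congr {V V' W W' : BilinSpace R} (h : V.Isometric V') (h' : W.Isometric W') :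
    (V.mul W).Isometric (V'.mul W') := by
  obtain ⟨e, he⟩ := h.exists_equiv
  obtain ⟨f, hf⟩ := h'.exists_equiv
  refine isometric_of (TensorProduct.congr e f) ?_
  change _ = LinearMap.BilinForm.tmul V.form W.form
  rw [← he, ← hf]
  ext; simp [mul]

lemma neg_congr {V W : BilinSpace R} (h : V.Isometric W) : V.neg.Isometric W.neg := by
  obtain ⟨e, he⟩ := h.exists_equiv
  refine isometric_of (V := V.neg) (W := W.neg) e ?_
  change _ = - V.form
  rw [← he]
  ext; simp [neg]

/-- Isometry classes of symmetric bilinear spaces. -/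
def IsoClass (R : Type u) [CommRing R] : Type (u + 1) := Quotient (setoid R)

/-- The isometry class of a symmetric bilinear space. -/
def isoClass (V : BilinSpace R) : IsoClass R := Quotient.mk _ V

lemma isoClass_eq_iff {V W : BilinSpace R} : V.isoClass = W.isoClass ↔ V.Isometric W :=
  Quotient.eq

lemma exists_isoClass_eq (x : IsoClass R) : ∃ V : BilinSpace R, V.isoClass = x :=
  Quotient.exists_rep x

instance : Zero (IsoClass R) := ⟨(zero R).isoClass⟩
instance : One (IsoClass R) := ⟨(one R).isoClass⟩
instance : Add (IsoClass R) :=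
  ⟨Quotient.map₂ add fun _ _ h _ _ h' => add_congr h h'⟩
instance : Mul (IsoClass R) :=
  ⟨Quotient.map₂ mul fun _ _ h _ _ h' => mul_congr h h'⟩

lemma isoClass_add (V W : BilinSpace R) : (V.add W).isoClass = V.isoClass + W.isoClass := rfl

lemma isoClass_mul (V W : BilinSpace R) : (V.mul W).isoClass = V.isoClass * W.isoClass := rfl

instance : CommSemiring (IsoClass R) where
  nsmul := nsmulRec
  npow := npowRec
  add_assoc := by
    rintro ⟨V⟩ ⟨W⟩ ⟨U⟩
    exact Quotient.sound (isometric_of (.prodAssoc R _ _ _) (by ext <;> simp [add]))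
  zero_add := by
    rintro ⟨V⟩
    exact Quotient.sound (isometric_of (.uniqueProd) (by ext <;> simp [add, zero]))
  add_zero := by
    rintro ⟨V⟩
    exact Quotient.sound (isometric_of (.prodUnique) (by ext <;> simp [add, zero]))
  add_comm := by
    rintro ⟨V⟩ ⟨W⟩
    exact Quotient.sound (isometric_of (.prodComm R _ _) (by ext <;> simp [add]))
  left_distrib := by
    rintro ⟨V⟩ ⟨W⟩ ⟨U⟩
    exact Quotient.sound (isometric_of (TensorProduct.prodRight R R _ _ _)
      (by ext <;> simp [add, mul]))
  right_distrib := by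
    rintro ⟨V⟩ ⟨W⟩ ⟨U⟩
    exact Quotient.sound (isometric_of (TensorProduct.prodLeft R R _ _ _)
      (by ext <;> simp [add, mul]))
  zero_mul := by
    rintro ⟨V⟩
    refine Quotient.sound (isometric_of (V := mul (zero R) V) (W := zero R) ?_ ?_)
    · exact { (0 : (PUnit.{u+1} ⊗[R] V.carrier) →ₗ[R] PUnit.{u+1}) with
        invFun := fun _ => 0
        left_inv := fun x => Subsingleton.elim (α := PUnit.{u+1} ⊗[R] V.carrier) _ _
        right_inv := fun _ => rfl }
    · ext; simp [mul, zero]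
  mul_zero := by
    rintro ⟨V⟩
    refine Quotient.sound (isometric_of (V := mul V (zero R)) (W := zero R) ?_ ?_)
    · exact { (0 : (V.carrier ⊗[R] PUnit.{u+1}) →ₗ[R] PUnit.{u+1}) with
        invFun := fun _ => 0
        left_inv := fun x => Subsingleton.elim (α := V.carrier ⊗[R] PUnit.{u+1}) _ _
        right_inv := fun _ => rfl }
    · ext; simp [mul, zero]
  mul_assoc := by
    rintro ⟨V⟩ ⟨W⟩ ⟨U⟩
    exact Quotient.sound (isometric_of (TensorProduct.assoc R _ _ _)
      (by ext; simp [mul, mul_assoc]))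
  mul_comm := by
    rintro ⟨V⟩ ⟨W⟩
    exact Quotient.sound (isometric_of (TensorProduct.comm R _ _)
      (by ext; simp [mul, mul_comm]))
  one_mul := by
    rintro ⟨V⟩
    exact Quotient.sound (isometric_of (TensorProduct.lid R _)
      (by ext; simp [mul, one]))
  mul_one := by
    rintro ⟨V⟩
    exact Quotient.sound (isometric_of (TensorProduct.rid R _)
      (by ext; simp [mul, one]))

lemma IsLagrangian.map {V W : BilinSpace R} (e : V.carrier ≃ₗ[R] W.carrier)
    (he : W.form.compl₁₂ e.toLinearMap e.toLinearMap = V.form) {N : Submodule R V.carrier}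
    (hV : V.IsLagrangian N) : W.IsLagrangian (N.map e.toLinearMap) := by
  obtain ⟨⟨N', hN⟩, h⟩ := hV
  refine ⟨⟨N'.map e.toLinearMap, ?_⟩, ?_⟩
  · exact hN.map (Submodule.orderIsoMapComap e)
  · ext x
    obtain ⟨x, rfl⟩ := e.surjective x
    have : e x ∈ N.map e.toLinearMap ↔ x ∈ N := by simp
    rw [this]
    conv_rhs => rw [← h, ← he]
    simp only [LinearMap.BilinForm.mem_orthogonal_iff, Submodule.mem_map,
      forall_exists_index, and_imp, forall_apply_eq_imp_iff₂, LinearMap.compl₁₂_apply]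
    rfl

lemma isMetabolic_zero : (zero R).IsMetabolic :=
  ⟨⊤, ⟨⊥, isCompl_top_bot⟩, by ext; simp [zero]⟩

lemma IsMetabolic.add {V W : BilinSpace R} (hV : V.IsMetabolic) (hW : W.IsMetabolic) :
    (V.add W).IsMetabolic := by
  obtain ⟨N, ⟨N', hN⟩, h⟩ := hV
  obtain ⟨M, ⟨M', hM⟩, h'⟩ := hW
  refine ⟨N.prod M, ⟨N'.prod M', ?_⟩, ?_⟩
  · constructor
    · rw [disjoint_iff, Submodule.prod_inf_prod, hN.inf_eq_bot, hM.inf_eq_bot, Submodule.prod_bot]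
    · rw [codisjoint_iff, Submodule.prod_sup_prod, hN.sup_eq_top, hM.sup_eq_top,
        Submodule.prod_top]
  · ext ⟨x, y⟩
    rw [Submodule.mem_prod]
    conv_rhs => rw [← h, ← h']
    constructor
    · intro hx
      exact ⟨fun n hn => by simpa [BilinSpace.add] using hx (n, 0) (by simpa using hn),
        fun n hn => by simpa [BilinSpace.add] using hx (0, n) (by simpa using hn)⟩
    · rintro ⟨h₁, h₂⟩ ⟨n, m⟩ ⟨hn, hm⟩
      have h1 := h₁ n hn
      have h2 := h₂ m hm
      simp only at h1 h2
      simp [BilinSpace.add, h1, h2]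

lemma isLagrangian_add_neg (V : BilinSpace R) : (V.add V.neg).IsLagrangian
    (LinearMap.range (LinearMap.prod (.id : V.carrier →ₗ[R] V.carrier) .id)) := by
  refine ⟨⟨LinearMap.range (LinearMap.inr R V.carrier V.carrier), ?_⟩, ?_⟩
  · constructor
    · rw [Submodule.disjoint_def]
      rintro _ ⟨x, rfl⟩ ⟨y, hy⟩
      have := congrArg Prod.fst hy
      simp at this
      simp [← this]
    · rw [codisjoint_iff, eq_top_iff]
      rintro ⟨x, y⟩ -
      exact Submodule.mem_sup.2 ⟨(x, x), ⟨x, rfl⟩, (0, y - x), ⟨y - x, rfl⟩, by simp⟩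
  · ext ⟨x, y⟩
    constructor
    · intro h
      refine ⟨x, Prod.ext rfl ?_⟩
      apply V.unimodular.1
      ext z
      have := h (z, z) ⟨z, rfl⟩
      change V.form x z = V.form y z
      rw [V.symm.eq x z, V.symm.eq y z]
      simpa [add, neg, add_neg_eq_zero] using this
    · rintro ⟨z, hz⟩ _ ⟨w, rfl⟩
      rw [← hz]
      simp [add, neg]

lemma isMetabolic_add_neg (V : BilinSpace R) : (V.add V.neg).IsMetabolic :=
  ⟨_, V.isLagrangian_add_neg⟩

lemma IsLagrangian.mul {V : BilinSpace R} {N : Submodule R V.carrier} (hV : V.IsLagrangian N)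
    (W : BilinSpace R) :
    (V.mul W).IsLagrangian (LinearMap.range (N.subtype.rTensor W.carrier)) := by
  obtain ⟨⟨N', hN⟩, h⟩ := hV
  let r : V.carrier →ₗ[R] N := N.projectionOnto N' hN
  have hr : r ∘ₗ N.subtype = .id := by ext x; simp [r]
  let i := N.subtype.rTensor W.carrier
  have hi : r.rTensor W.carrier ∘ₗ i = .id := by
    simp only [i, ← LinearMap.rTensor_comp, hr, LinearMap.rTensor_id]
  let p : V.carrier →ₗ[R] Module.Dual R N := N.subtype.dualMap ∘ₗ V.form
  have hp : Function.Surjective p := fun f => by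
    obtain ⟨v, hv⟩ := V.unimodular.2 (f ∘ₗ r)
    refine ⟨v, ?_⟩
    ext n
    have : r n = n := LinearMap.congr_fun hr n
    simp [p, hv, this]
  have hex : Function.Exact N.subtype p := by
    intro x
    have : x ∈ Set.range N.subtype ↔ x ∈ N := by simp
    rw [this]
    conv_rhs => rw [← h]
    constructor
    · intro hx n hn
      rw [← V.symm.eq]
      exact LinearMap.congr_fun hx ⟨n, hn⟩
    · intro hx
      ext n
      have := hx n n.2
      rw [← V.symm.eq] at this
      exact this
  have hex' := rTensor_exact W.carrier hex hp
  let Ψ : Module.Dual R N ⊗[R] W.carrier →ₗ[R] W.carrier →ₗ[R] Module.Dual R N :=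
    dualTensorHom R W.carrier (Module.Dual R N) ∘ₗ
      (TensorProduct.comm R _ _).toLinearMap ∘ₗ W.form.lTensor (Module.Dual R N)
  have hΨ : Function.Injective Ψ := by
    have h2 : Function.Injective (W.form.lTensor (Module.Dual R N)) :=
      ((LinearEquiv.ofBijective W.form W.unimodular).lTensor (Module.Dual R N)).injective
    exact dualTensorHom_bijective.1.comp ((TensorProduct.comm R _ _).injective.comp h2)
  have key : ∀ (z : V.carrier ⊗[R] W.carrier) (n : N) (w : W.carrier),
      Ψ (p.rTensor W.carrier z) w n = (V.mul W).form z ((n : V.carrier) ⊗ₜ w) := by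
    intro z n w
    induction z with
    | zero => simp
    | add x y hx hy => simp only [map_add, LinearMap.add_apply, hx, hy]
    | tmul x y => simp [Ψ, p, BilinSpace.mul]
  refine ⟨⟨LinearMap.ker (r.rTensor W.carrier), ?_⟩, ?_⟩
  · constructor
    · rw [Submodule.disjoint_def]
      rintro _ ⟨x, rfl⟩ hx
      have : x = 0 := (LinearMap.congr_fun hi x).symm.trans hx
      simp [this]
    · rw [codisjoint_iff, eq_top_iff]
      rintro z -
      refine Submodule.mem_sup.2 ⟨i (r.rTensor W.carrier z), ⟨_, rfl⟩,
        z - i (r.rTensor W.carrier z), ?_, by simp⟩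
      have := LinearMap.congr_fun hi (r.rTensor W.carrier z)
      simp only [LinearMap.comp_apply, LinearMap.id_apply] at this
      rw [LinearMap.mem_ker, map_sub, this, sub_self]
  · ext z
    have : z ∈ LinearMap.range i ↔ p.rTensor W.carrier z = 0 := (hex' z).symm
    rw [this]
    constructor
    · intro hz
      apply hΨ
      ext w n
      rw [key, (V.mul W).symm.eq]
      exact hz _ ⟨n ⊗ₜ w, rfl⟩
    · rintro hz _ ⟨t, rfl⟩
      rw [← (V.mul W).symm.eq]
      induction t with
      | zero => simp
      | add x y hx hy => rw [map_add, map_add, hx, hy, add_zero]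
      | tmul n w =>
        have := key z n w
        rw [hz] at this
        simpa [i] using this.symm

lemma IsMetabolic.mul {V : BilinSpace R} (hV : V.IsMetabolic) (W : BilinSpace R) :
    (V.mul W).IsMetabolic := by
  obtain ⟨N, hN⟩ := hV
  exact ⟨_, hN.mul W⟩

/-- Witt equivalence of isometry classes: equality after adding metabolic spaces. -/
def wittCon (R : Type u) [CommRing R] : RingCon (IsoClass R) where
  r x y := ∃ M N : BilinSpace R, M.IsMetabolic ∧ N.IsMetabolic ∧
    x + M.isoClass = y + N.isoClass
  iseqv := by
    refine ⟨fun x => ⟨zero R, zero R, isMetabolic_zero, isMetabolic_zero, rfl⟩, ?_, ?_⟩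
    · rintro x y ⟨M, N, hM, hN, h⟩
      exact ⟨N, M, hN, hM, h.symm⟩
    · rintro x y z ⟨M, N, hM, hN, h⟩ ⟨M', N', hM', hN', h'⟩
      refine ⟨M.add M', N'.add N, hM.add hM', hN'.add hN, ?_⟩
      change x + (M.isoClass + M'.isoClass) = z + (N'.isoClass + N.isoClass)
      rw [← add_assoc, h, add_right_comm, h', add_assoc]
  add' := by
    rintro x y z t ⟨M, N, hM, hN, h⟩ ⟨M', N', hM', hN', h'⟩
    refine ⟨M.add M', N.add N', hM.add hM', hN.add hN', ?_⟩
    change x + z + (M.isoClass + M'.isoClass) = y + t + (N.isoClass + N'.isoClass)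
    rw [add_add_add_comm, h, h', add_add_add_comm]
  mul' := by
    intro x y z t h h'
    obtain ⟨x, rfl⟩ := exists_isoClass_eq x
    obtain ⟨y, rfl⟩ := exists_isoClass_eq y
    obtain ⟨z, rfl⟩ := exists_isoClass_eq z
    obtain ⟨t, rfl⟩ := exists_isoClass_eq t
    obtain ⟨M, N, hM, hN, h1⟩ := h
    obtain ⟨M', N', hM', hN', h2⟩ := h'
    refine ⟨((M'.mul x).add (M.mul z)).add (M.mul M'), ((N'.mul y).add (N.mul t)).add (N.mul N'),
      ((hM'.mul x).add (hM.mul z)).add (hM.mul M'),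
      ((hN'.mul y).add (hN.mul t)).add (hN.mul N'), ?_⟩
    change x.isoClass * z.isoClass +
        (M'.isoClass * x.isoClass + M.isoClass * z.isoClass + M.isoClass * M'.isoClass) =
      y.isoClass * t.isoClass +
        (N'.isoClass * y.isoClass + N.isoClass * t.isoClass + N.isoClass * N'.isoClass)
    calc _ = (x.isoClass + M.isoClass) * (z.isoClass + M'.isoClass) := by ring
      _ = (y.isoClass + N.isoClass) * (t.isoClass + N'.isoClass) := by rw [h1, h2]
      _ = _ := by ring

end BilinSpace

/-- The Witt ring of symmetric bilinear spaces over `R`. -/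
def WittRing (R : Type u) [CommRing R] : Type (u + 1) := (BilinSpace.wittCon R).Quotient

namespace WittRing

variable {R : Type u} [CommRing R]

instance : CommSemiring (WittRing R) :=
  inferInstanceAs (CommSemiring (BilinSpace.wittCon R).Quotient)

end WittRing

/-- The class of a symmetric bilinear space in the Witt ring. -/
def BilinSpace.wittClass {R : Type u} [CommRing R] (V : BilinSpace R) : WittRing R :=
  RingCon.toQuotient (c := BilinSpace.wittCon R) V.isoClass

namespace WittRing

open BilinSpace

variable {R : Type u} [CommRing R]

lemma exists_wittClass_eq (x : WittRing R) : ∃ V : BilinSpace R, V.wittClass = x := by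
  obtain ⟨y, rfl⟩ := Quotient.exists_rep x
  obtain ⟨V, rfl⟩ := exists_isoClass_eq y
  exact ⟨V, rfl⟩

lemma wittClass_eq_iff {V W : BilinSpace R} : V.wittClass = W.wittClass ↔
    ∃ M N : BilinSpace R, M.IsMetabolic ∧ N.IsMetabolic ∧ (V.add M).Isometric (W.add N) := by
  have h : V.wittClass = W.wittClass ↔ wittCon R V.isoClass W.isoClass := (wittCon R).eq
  rw [h]
  refine ⟨?_, ?_⟩
  · rintro ⟨M, N, hM, hN, h⟩
    exact ⟨M, N, hM, hN, isoClass_eq_iff.1 h⟩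
  · rintro ⟨M, N, hM, hN, h⟩
    exact ⟨M, N, hM, hN, isoClass_eq_iff.2 h⟩

lemma wittClass_add (V W : BilinSpace R) : (V.add W).wittClass = V.wittClass + W.wittClass := rfl

lemma wittClass_mul (V W : BilinSpace R) : (V.mul W).wittClass = V.wittClass * W.wittClass := rfl

lemma wittClass_zero : (zero R).wittClass = 0 := rfl

lemma wittClass_one : (one R).wittClass = 1 := rfl

lemma wittClass_eq_zero_of_isMetabolic {V : BilinSpace R} (h : V.IsMetabolic) :
    V.wittClass = 0 := by
  rw [← wittClass_zero, wittClass_eq_iff]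
  exact ⟨zero R, V, isMetabolic_zero, h, isoClass_eq_iff.1 (add_comm V.isoClass (zero R).isoClass)⟩

lemma wittClass_add_neg (V : BilinSpace R) : V.wittClass + V.neg.wittClass = 0 :=
  wittClass_eq_zero_of_isMetabolic (isMetabolic_add_neg V)

lemma neg_well_defined {V W : BilinSpace R} (h : V.wittClass = W.wittClass) :
    V.neg.wittClass = W.neg.wittClass := by
  calc V.neg.wittClass = V.neg.wittClass + (W.wittClass + W.neg.wittClass) := by
        rw [wittClass_add_neg, add_zero]
    _ = (V.wittClass + V.neg.wittClass) + W.neg.wittClass := by rw [h]; ring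
    _ = _ := by rw [wittClass_add_neg, zero_add]

instance : Neg (WittRing R) where
  neg x := (exists_wittClass_eq x).choose.neg.wittClass

lemma neg_wittClass (V : BilinSpace R) : -V.wittClass = V.neg.wittClass :=
  neg_well_defined (exists_wittClass_eq V.wittClass).choose_spec

instance : CommRing (WittRing R) where
  zsmul := zsmulRec
  neg_add_cancel x := by
    obtain ⟨V, rfl⟩ := exists_wittClass_eq x
    rw [neg_wittClass, add_comm, wittClass_add_neg]

/-- The fundamental ideal of the Witt ring (for a local ring `R`): the ideal of the classes of the
spaces of even rank. -/
def fundamentalIdeal (R : Type u) [CommRing R] : Ideal (WittRing R) :=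
  Ideal.span {x | ∃ V : BilinSpace R, Even (Module.finrank R V.carrier) ∧ V.wittClass = x}

end WittRing

/-- A nonsingular quadratic space over `R`: a finitely generated free module with a quadratic form
whose polar form is unimodular. -/
structure QuadSpace (R : Type u) [CommRing R] : Type (u + 1) where
  carrier : Type u
  [addCommGroup : AddCommGroup carrier]
  [module : Module R carrier]
  [free : Module.Free R carrier]
  [finite : Module.Finite R carrier]
  form : QuadraticForm R carrier
  unimodular : Function.Bijective form.polarBilin

namespace QuadSpace

attribute [instance] addCommGroup module free finite

variable {R : Type u} [CommRing R]

/-- Isometry of quadratic spaces. -/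
def Isometric (V W : QuadSpace R) : Prop := V.form.Equivalent W.form

lemma isometric_of {V W : QuadSpace R} (e : V.carrier ≃ₗ[R] W.carrier)
    (h : W.form.comp e.toLinearMap = V.form) : V.Isometric W :=
  ⟨{ e with map_app' := fun x => DFunLike.congr_fun h x }⟩

lemma Isometric.exists_equiv {V W : QuadSpace R} (h : V.Isometric W) :
    ∃ e : V.carrier ≃ₗ[R] W.carrier, W.form.comp e.toLinearMap = V.form := by
  obtain ⟨e⟩ := h
  exact ⟨e.toLinearEquiv, by ext x; exact e.map_app x⟩

instance setoid (R : Type u) [CommRing R] : Setoid (QuadSpace R) where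
  r := Isometric
  iseqv := ⟨fun V => .refl V.form, fun h => h.symm, fun h h' => h.trans h'⟩

/-- The polar form of a quadratic space, a symmetric bilinear space on the same module. -/
abbrev polarSpace (V : QuadSpace R) : BilinSpace R where
  carrier := V.carrier
  form := V.form.polarBilin
  symm := ⟨fun x y => QuadraticMap.polar_comm _ x y⟩
  unimodular := V.unimodular

/-- The zero space. -/
abbrev zero (R : Type u) [CommRing R] : QuadSpace R where
  carrier := PUnit
  form := 0
  unimodular := ⟨fun _ _ _ => rfl, fun f => ⟨0, LinearMap.ext fun x => by
    rw [show f x = 0 from map_zero f]; simp [QuadraticMap.polar]⟩⟩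

/-- Orthogonal sum. -/
abbrev add (V W : QuadSpace R) : QuadSpace R where
  carrier := V.carrier × W.carrier
  form := V.form.prod W.form
  unimodular := by
    have h : (V.form.prod W.form).polarBilin = (V.polarSpace.add W.polarSpace).form := by
      ext <;> simp
    rw [h]
    exact (V.polarSpace.add W.polarSpace).unimodular

/-- The space with the form multiplied by `-1`. -/
abbrev neg (V : QuadSpace R) : QuadSpace R where
  carrier := V.carrier
  form := -V.form
  unimodular := by
    have h : (-V.form).polarBilin = V.polarSpace.neg.form := by
      ext; simp [QuadraticMap.polar_neg]
    rw [h]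
    exact V.polarSpace.neg.unimodular

/-- The tensor product of a symmetric bilinear form `b` and a quadratic form `q` on a free module:
`z ↦ (b ⊗ a)(z, z)` where `a` is any bilinear form with `a(w, w) = q(w)`. It is the quadratic form
with value `b(v, v) q(w)` at `v ⊗ w` and with polar form `b ⊗ polar(q)`. -/
def tensorForm {V W : Type u} [AddCommGroup V] [Module R V] [AddCommGroup W] [Module R W]
    [Module.Free R W] (b : LinearMap.BilinForm R V) (q : QuadraticForm R W) :
    QuadraticForm R (V ⊗[R] W) :=
  (LinearMap.BilinForm.tmul b
    (LinearMap.BilinMap.toQuadraticMap_surjective q).choose).toQuadraticMap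

section tensorForm

variable {V W : Type u} [AddCommGroup V] [Module R V] [AddCommGroup W] [Module R W]

lemma tmul_self_eq_zero {b : LinearMap.BilinForm R V} (hb : b.IsSymm)
    {c : LinearMap.BilinForm R W} (hc : ∀ w, c w w = 0) (z : V ⊗[R] W) :
    LinearMap.BilinForm.tmul b c z z = 0 := by
  have hc' : c.flip = -c := by
    ext x y
    have := hc (x + y)
    simp only [map_add, LinearMap.add_apply, hc, zero_add, add_zero] at this
    change c y x = -c x y
    linear_combination this
  have hb' : b.flip = b := by ext x y; exact hb.eq y x
  have hflip : (LinearMap.BilinForm.tmul b c).flip = -LinearMap.BilinForm.tmul b c := by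
    have : (LinearMap.BilinForm.tmul b c).flip = LinearMap.BilinForm.tmul b.flip c.flip := by
      ext; simp
    rw [this, hb', hc']
    ext; simp
  induction z with
  | zero => simp
  | tmul v w => simp [hc]
  | add x y hx hy =>
    have := LinearMap.congr_fun₂ hflip x y
    simp only [LinearMap.flip_apply, LinearMap.neg_apply] at this
    simp only [map_add, LinearMap.add_apply, hx, hy, this]
    ring

variable [Module.Free R W]

lemma tensorForm_eq {b : LinearMap.BilinForm R V} (hb : b.IsSymm) {q : QuadraticForm R W}
    {a : LinearMap.BilinForm R W} (ha : a.toQuadraticMap = q) :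
    tensorForm b q = (LinearMap.BilinForm.tmul b a).toQuadraticMap := by
  ext z
  have h := (LinearMap.BilinMap.toQuadraticMap_surjective q).choose_spec
  set a' := (LinearMap.BilinMap.toQuadraticMap_surjective q).choose
  have hc : ∀ w, (a' - a) w w = 0 := fun w => by
    have h1 := DFunLike.congr_fun h w
    have h2 := DFunLike.congr_fun ha w
    simp only [LinearMap.BilinMap.toQuadraticMap_apply] at h1 h2
    simp [h1, h2]
  have h0 := tmul_self_eq_zero hb hc z
  have h1 : LinearMap.BilinForm.tmul b (a' - a) =
      LinearMap.BilinForm.tmul b a' - LinearMap.BilinForm.tmul b a := by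
    ext; simp [sub_mul]
  rw [h1] at h0
  exact sub_eq_zero.1 h0

lemma tensorForm_tmul {b : LinearMap.BilinForm R V} (q : QuadraticForm R W) (v : V) (w : W) :
    tensorForm b q (v ⊗ₜ w) = b v v * q w := by
  have h := (LinearMap.BilinMap.toQuadraticMap_surjective q).choose_spec
  have h1 := DFunLike.congr_fun h w
  simp only [LinearMap.BilinMap.toQuadraticMap_apply] at h1
  simp [tensorForm, h1, mul_comm]

lemma polarBilin_tensorForm {b : LinearMap.BilinForm R V} (hb : b.IsSymm)
    (q : QuadraticForm R W) :
    (tensorForm b q).polarBilin = LinearMap.BilinForm.tmul b q.polarBilin := by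
  have h := (LinearMap.BilinMap.toQuadraticMap_surjective q).choose_spec
  set a := (LinearMap.BilinMap.toQuadraticMap_surjective q).choose
  rw [tensorForm_eq hb h, ← h]
  ext v w v' w'
  simp [LinearMap.BilinMap.polar_toQuadraticMap, hb.eq v' v, add_mul]

end tensorForm

/-- The product of a symmetric bilinear space and a quadratic space. -/
abbrev tensor (V : BilinSpace R) (W : QuadSpace R) : QuadSpace R where
  carrier := V.carrier ⊗[R] W.carrier
  form := tensorForm V.form W.form
  unimodular := by
    rw [polarBilin_tensorForm V.symm]
    exact (V.mul W.polarSpace).unimodular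

lemma polarSpace_form (V : QuadSpace R) : V.polarSpace.form = V.form.polarBilin := rfl

lemma add_form (V W : QuadSpace R) : (V.add W).form = V.form.prod W.form := rfl

lemma tensor_form (V : BilinSpace R) (W : QuadSpace R) :
    (tensor V W).form = tensorForm V.form W.form := rfl

/-- A quadratic space is hyperbolic if it is isometric to the hyperbolic space
`(f, x) ↦ f x` on `M* × M` of some finitely generated projective module `M`. -/
def IsHyperbolic (V : QuadSpace R) : Prop :=
  ∃ (M : Type u) (_ : AddCommGroup M) (_ : Module R M),
    Module.Finite R M ∧ Module.Projective R M ∧ V.form.Equivalent (QuadraticForm.dualProd R M)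

lemma isHyperbolic_of_isLagrangian {V : QuadSpace R} {N : Submodule R V.carrier}
    (hN : V.polarSpace.IsLagrangian N) (h0 : ∀ x ∈ N, V.form x = 0) : V.IsHyperbolic := by
  obtain ⟨⟨N', hc⟩, ho⟩ := hN
  have hsplit : (N'.projectionOnto N hc.symm) ∘ₗ N'.subtype = .id := by ext x; simp
  have hfin : Module.Finite R N' :=
    Module.Finite.of_surjective (N'.projectionOnto N hc.symm)
      fun x => ⟨x, LinearMap.congr_fun hsplit x⟩
  have hproj : Module.Projective R N' := Module.Projective.of_split _ _ hsplit
  have hmem : ∀ x, x ∈ N ↔ ∀ n ∈ N, V.form.polarBilin n x = 0 := fun x => by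
    conv_lhs => rw [← ho]
    rfl
  let d₀ : N →ₗ[R] Module.Dual R N' := N'.subtype.dualMap ∘ₗ V.form.polarBilin ∘ₗ N.subtype
  have hd₀ : Function.Bijective d₀ := by
    constructor
    · rw [injective_iff_map_eq_zero]
      intro n hn
      apply Subtype.ext
      apply V.unimodular.1
      ext v
      obtain ⟨x, hx, y, hy, rfl⟩ := Submodule.mem_sup.1
        (hc.sup_eq_top ▸ Submodule.mem_top : v ∈ N ⊔ N')
      have h1 : V.form.polarBilin n x = 0 := (hmem x).1 hx n n.2
      have h2 : V.form.polarBilin n y = 0 := LinearMap.congr_fun hn ⟨y, hy⟩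
      rw [map_add, h1, h2]
      simp
    · intro f
      obtain ⟨v, hv⟩ := V.unimodular.2 (f ∘ₗ N'.projectionOnto N hc.symm)
      have hvN : v ∈ N := by
        rw [hmem]
        intro n hn
        rw [V.polarSpace.symm.eq n v]
        change V.form.polarBilin v n = 0
        rw [hv]
        have : N'.projectionOnto N hc.symm n = 0 := by
          simpa [Submodule.projectionOnto_apply_eq_zero_iff] using hn
        simp [this]
      refine ⟨⟨v, hvN⟩, ?_⟩
      ext x
      have : d₀ ⟨v, hvN⟩ x = V.form.polarBilin v x := rfl
      rw [this, hv]
      simp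
  let d := LinearEquiv.ofBijective d₀ hd₀
  obtain ⟨a, ha⟩ := LinearMap.BilinMap.toQuadraticMap_surjective V.form
  let s : N' →ₗ[R] Module.Dual R N' := N'.subtype.dualMap ∘ₗ a ∘ₗ N'.subtype
  let g : N × N' →ₗ[R] Module.Dual R N' × N' :=
    (d.toLinearMap ∘ₗ .fst R _ _ + s ∘ₗ .snd R _ _).prod (.snd R _ _)
  let g' : Module.Dual R N' × N' →ₗ[R] N × N' :=
    (d.symm.toLinearMap ∘ₗ (.fst R _ _ - s ∘ₗ .snd R _ _)).prod (.snd R _ _)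
  have h1 : g ∘ₗ g' = .id := LinearMap.ext fun x => by simp [g, g']
  have h2 : g' ∘ₗ g = .id := LinearMap.ext fun x => by simp [g, g']
  let e : (N × N') ≃ₗ[R] Module.Dual R N' × N' := .ofLinearMap g g' h1 h2
  refine ⟨N', inferInstance, inferInstance, hfin, hproj, ?_⟩
  refine QuadraticMap.Equivalent.symm ⟨{ e.symm ≪≫ₗ Submodule.prodEquivOfIsCompl N N' hc with
    map_app' := ?_ }⟩
  intro z
  obtain ⟨⟨x, y⟩, rfl⟩ := e.surjective z
  have hl : (e.symm ≪≫ₗ Submodule.prodEquivOfIsCompl N N' hc) (e (x, y)) =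
      (x : V.carrier) + y := by simp
  refine (congrArg V.form hl).trans ?_
  rw [QuadraticMap.map_add V.form, h0 x x.2, zero_add]
  have h3 : V.form (y : V.carrier) = a y y := (DFunLike.congr_fun ha (y : V.carrier)).symm
  have h4 : QuadraticForm.dualProd R N' (e (x, y)) = QuadraticMap.polar V.form x y + a y y := rfl
  rw [h3, h4, add_comm]

lemma IsHyperbolic.exists_isLagrangian {V : QuadSpace R} (hV : V.IsHyperbolic) :
    ∃ N : Submodule R V.carrier, V.polarSpace.IsLagrangian N ∧ ∀ x ∈ N, V.form x = 0 := by
  obtain ⟨M, _, _, hf, hp, ⟨e⟩⟩ := hV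
  have he : ∀ x, V.form x = (e x).1 (e x).2 := fun x => (e.map_app x).symm
  have hpol : ∀ x y, V.form.polarBilin x y = (e x).1 (e y).2 + (e y).1 (e x).2 := by
    intro x y
    simp only [QuadraticMap.polarBilin_apply_apply, QuadraticMap.polar, he, map_add, Prod.fst_add,
      Prod.snd_add, LinearMap.add_apply]
    ring
  let f : V.carrier ≃ₗ[R] Module.Dual R M × M := e.toLinearEquiv
  have hfe : ∀ x, f x = e x := fun _ => rfl
  refine ⟨LinearMap.ker (LinearMap.snd R _ _ ∘ₗ f.toLinearMap),
    ⟨⟨LinearMap.ker (LinearMap.fst R _ _ ∘ₗ f.toLinearMap), ?_⟩, ?_⟩, ?_⟩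
  · constructor
    · rw [Submodule.disjoint_def]
      intro x hx hx'
      exact f.injective (by rw [map_zero]; exact Prod.ext hx' hx)
    · rw [codisjoint_iff, eq_top_iff]
      rintro x -
      refine Submodule.mem_sup.2 ⟨f.symm ((f x).1, 0), by simp, f.symm (0, (f x).2), by simp, ?_⟩
      rw [← map_add]
      simp
  · ext x
    constructor
    · intro hx
      change (f x).2 = 0
      rw [← Module.forall_dual_apply_eq_zero_iff R]
      intro φ
      have := hx (f.symm (φ, 0)) (by simp)
      have h2 := hpol (f.symm (φ, 0)) x
      rw [← hfe, ← hfe] at h2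
      simp only [LinearEquiv.apply_symm_apply, map_zero, add_zero] at h2
      exact h2.symm.trans this
    · intro hx n hn
      have hx' : (e x).2 = 0 := hx
      have hn' : (e n).2 = 0 := hn
      refine (hpol n x).trans ?_
      rw [hx', hn', map_zero, map_zero, add_zero]
  · intro x hx
    have hx' : (e x).2 = 0 := hx
    rw [he, hx', map_zero]

lemma isHyperbolic_zero : (zero R).IsHyperbolic :=
  isHyperbolic_of_isLagrangian (N := ⊤)
    ⟨⟨⊥, isCompl_top_bot⟩, by ext; simp [QuadraticMap.polar]⟩ (by simp)

lemma IsHyperbolic.add {V W : QuadSpace R} (hV : V.IsHyperbolic) (hW : W.IsHyperbolic) :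
    (V.add W).IsHyperbolic := by
  obtain ⟨M, _, _, hf, hp, e⟩ := hV
  obtain ⟨N, _, _, hf', hp', e'⟩ := hW
  exact ⟨M × N, inferInstance, inferInstance, inferInstance, inferInstance,
    (e.prod e').trans ⟨QuadraticForm.dualProdProdIsometry.symm⟩⟩

lemma isHyperbolic_add_neg (V : QuadSpace R) : (V.add V.neg).IsHyperbolic := by
  refine isHyperbolic_of_isLagrangian
    (N := LinearMap.range (LinearMap.prod (.id : V.carrier →ₗ[R] V.carrier) .id)) ?_ ?_
  · have := V.polarSpace.isLagrangian_add_neg.map (V := V.polarSpace.add V.polarSpace.neg) (W := (V.add V.neg).polarSpace)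
      (.refl R (V.carrier × V.carrier)) (by ext <;> simp [QuadraticMap.polar_neg])
    simpa using this
  · rintro _ ⟨x, rfl⟩
    simp

lemma isHyperbolic_tensor_of_isMetabolic {V : BilinSpace R} (hV : V.IsMetabolic)
    (W : QuadSpace R) : (tensor V W).IsHyperbolic := by
  obtain ⟨N, hN⟩ := hV
  have hNN : ∀ m n : N, V.form m n = 0 := fun m n => by
    have : (n : V.carrier) ∈ V.form.orthogonal N := by rw [hN.2]; exact n.2
    exact this m m.2
  refine isHyperbolic_of_isLagrangian
    (N := LinearMap.range (N.subtype.rTensor W.carrier)) ?_ ?_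
  · have := (hN.mul W.polarSpace).map (V := V.mul W.polarSpace)
      (W := (tensor V W).polarSpace) (.refl R (V.carrier ⊗[R] W.carrier))
      (by rw [polarSpace_form, tensor_form, polarBilin_tensorForm V.symm]; rfl)
    simpa using this
  · rintro _ ⟨t, rfl⟩
    obtain ⟨a, ha⟩ := LinearMap.BilinMap.toQuadraticMap_surjective W.form
    rw [tensor_form, tensorForm_eq V.symm ha]
    have : (LinearMap.BilinForm.tmul V.form a).compl₁₂ (N.subtype.rTensor W.carrier)
        (N.subtype.rTensor W.carrier) = 0 := by
      ext; simp [hNN]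
    exact LinearMap.congr_fun₂ this t t

lemma IsHyperbolic.tensor (V : BilinSpace R) {W : QuadSpace R} (hW : W.IsHyperbolic) :
    (tensor V W).IsHyperbolic := by
  obtain ⟨N, hN, h0⟩ := hW.exists_isLagrangian
  let e : W.carrier ⊗[R] V.carrier ≃ₗ[R] V.carrier ⊗[R] W.carrier := TensorProduct.comm R _ _
  refine isHyperbolic_of_isLagrangian
    (N := (LinearMap.range (N.subtype.rTensor V.carrier)).map e.toLinearMap) ?_ ?_
  · refine (hN.mul V).map (W := (QuadSpace.tensor V W).polarSpace) e ?_
    rw [polarSpace_form, tensor_form, polarBilin_tensorForm V.symm]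
    ext; simp [e, mul_comm]
  · rintro _ ⟨_, ⟨t, rfl⟩, rfl⟩
    obtain ⟨a, ha⟩ := LinearMap.BilinMap.toQuadraticMap_surjective W.form
    have h1 : ∀ n : N, a n n = 0 := fun n => (DFunLike.congr_fun ha (n : W.carrier)).trans (h0 n n.2)
    rw [tensor_form, tensorForm_eq V.symm ha]
    have h2 : ∀ z, LinearMap.BilinForm.tmul V.form (a.compl₁₂ N.subtype N.subtype) z z = 0 :=
      tmul_self_eq_zero V.symm h1
    have h3 : (LinearMap.BilinForm.tmul V.form a).compl₁₂
        (e.toLinearMap ∘ₗ N.subtype.rTensor V.carrier)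
        (e.toLinearMap ∘ₗ N.subtype.rTensor V.carrier) =
        (LinearMap.BilinForm.tmul V.form (a.compl₁₂ N.subtype N.subtype)).compl₁₂
          (TensorProduct.comm R _ _).toLinearMap (TensorProduct.comm R _ _).toLinearMap := by
      ext; simp [e]
    exact (LinearMap.congr_fun₂ h3 t t).trans (h2 _)

lemma add_congr {V V' W W' : QuadSpace R} (h : V.Isometric V') (h' : W.Isometric W') :
    (V.add W).Isometric (V'.add W') := QuadraticMap.Equivalent.prod h h'

/-- Reduces an isometry of products to an identity of bilinear forms. -/
lemma tensor_isometric {V V' : BilinSpace R} {W W' : QuadSpace R}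
    (e : V.carrier ⊗[R] W.carrier ≃ₗ[R] V'.carrier ⊗[R] W'.carrier)
    (a : LinearMap.BilinForm R W.carrier) (a' : LinearMap.BilinForm R W'.carrier)
    (ha : a.toQuadraticMap = W.form) (ha' : a'.toQuadraticMap = W'.form)
    (h : (LinearMap.BilinForm.tmul V'.form a').compl₁₂ e.toLinearMap e.toLinearMap =
      LinearMap.BilinForm.tmul V.form a) : (tensor V W).Isometric (tensor V' W') := by
  refine isometric_of (V := QuadSpace.tensor V W) (W := QuadSpace.tensor V' W') e ?_
  ext z
  rw [tensor_form, tensor_form, tensorForm_eq V.symm ha, tensorForm_eq V'.symm ha', ← h]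
  rfl

lemma tensor_congr {V V' : BilinSpace R} {W W' : QuadSpace R} (h : V.Isometric V')
    (h' : W.Isometric W') : (tensor V W).Isometric (tensor V' W') := by
  obtain ⟨e, he⟩ := h.exists_equiv
  obtain ⟨f, hf⟩ := h'.exists_equiv
  obtain ⟨a, ha⟩ := LinearMap.BilinMap.toQuadraticMap_surjective W'.form
  refine tensor_isometric (TensorProduct.congr e f)
    (a.compl₁₂ f.toLinearMap f.toLinearMap) a ?_ ha ?_
  · rw [← hf, ← ha]; rfl
  · rw [← he]
    ext; simp

/-- Isometry classes of quadratic spaces. -/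
def IsoClass (R : Type u) [CommRing R] : Type (u + 1) := Quotient (setoid R)

/-- The isometry class of a quadratic space. -/
def isoClass (V : QuadSpace R) : IsoClass R := Quotient.mk _ V

lemma isoClass_eq_iff {V W : QuadSpace R} : V.isoClass = W.isoClass ↔ V.Isometric W :=
  Quotient.eq

lemma exists_isoClass_eq (x : IsoClass R) : ∃ V : QuadSpace R, V.isoClass = x :=
  Quotient.exists_rep x

instance : Zero (IsoClass R) := ⟨(zero R).isoClass⟩
instance : Add (IsoClass R) :=
  ⟨Quotient.map₂ add fun _ _ h _ _ h' => add_congr h h'⟩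
instance : SMul (BilinSpace.IsoClass R) (IsoClass R) :=
  ⟨Quotient.map₂ tensor fun _ _ h _ _ h' => tensor_congr h h'⟩

lemma isoClass_add (V W : QuadSpace R) : (V.add W).isoClass = V.isoClass + W.isoClass := rfl

lemma isoClass_tensor (V : BilinSpace R) (W : QuadSpace R) :
    (tensor V W).isoClass = V.isoClass • W.isoClass := rfl

instance : AddCommMonoid (IsoClass R) where
  nsmul := nsmulRec
  add_assoc := by
    rintro ⟨V⟩ ⟨W⟩ ⟨U⟩
    exact Quotient.sound (isometric_of (.prodAssoc R _ _ _) (by ext; simp [add_assoc]))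
  zero_add := by
    rintro ⟨V⟩
    exact Quotient.sound (isometric_of (.uniqueProd) (by ext; simp))
  add_zero := by
    rintro ⟨V⟩
    exact Quotient.sound (isometric_of (.prodUnique) (by ext; simp))
  add_comm := by
    rintro ⟨V⟩ ⟨W⟩
    exact Quotient.sound (isometric_of (.prodComm R _ _) (by ext; simp [add_comm]))

lemma prod_toQuadraticMap {V W : Type u} [AddCommGroup V] [Module R V] [AddCommGroup W]
    [Module R W] (a : LinearMap.BilinForm R V) (b : LinearMap.BilinForm R W) :
    LinearMap.BilinMap.toQuadraticMap (a.compl₁₂ (.fst R V W) (.fst R V W) +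
      b.compl₁₂ (.snd R V W) (.snd R V W)) = a.toQuadraticMap.prod b.toQuadraticMap := by
  ext; simp

lemma toQuadraticMap_comp_eq {V W : Type u} [AddCommGroup V] [Module R V] [AddCommGroup W]
    [Module R W] (a : LinearMap.BilinForm R V) (b : LinearMap.BilinForm R W) (e : W →ₗ[R] V)
    (h : a.compl₁₂ e e = b) : (LinearMap.BilinMap.toQuadraticMap a).comp e = b.toQuadraticMap := by
  rw [← h]; rfl

instance : Module (BilinSpace.IsoClass R) (IsoClass R) where
  one_smul := by
    rintro ⟨V⟩
    obtain ⟨a, ha⟩ := LinearMap.BilinMap.toQuadraticMap_surjective V.form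
    refine Quotient.sound (isometric_of (V := tensor (BilinSpace.one R) V)
      (TensorProduct.lid R _) ?_)
    rw [tensor_form, tensorForm_eq (BilinSpace.one R).symm ha, ← ha]
    have : a.compl₁₂ (TensorProduct.lid R _).toLinearMap (TensorProduct.lid R _).toLinearMap =
      LinearMap.BilinForm.tmul (BilinSpace.one R).form a := by ext; simp
    rw [← this]
    rfl
  mul_smul := by
    rintro ⟨V⟩ ⟨W⟩ ⟨U⟩
    obtain ⟨a, ha⟩ := LinearMap.BilinMap.toQuadraticMap_surjective U.form
    exact Quotient.sound (tensor_isometric (V := V.mul W) (V' := V) (W := U) (W' := tensor W U)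
      (TensorProduct.assoc R _ _ _) a (LinearMap.BilinForm.tmul W.form a) ha
      (tensorForm_eq W.symm ha).symm (by ext; simp [mul_assoc]))
  smul_zero := by
    rintro ⟨V⟩
    refine Quotient.sound (isometric_of (V := tensor V (zero R)) (W := zero R) ?_ ?_)
    · exact { (0 : (V.carrier ⊗[R] PUnit.{u+1}) →ₗ[R] PUnit.{u+1}) with
        invFun := fun _ => 0
        left_inv := fun x => Subsingleton.elim (α := V.carrier ⊗[R] PUnit.{u+1}) _ _
        right_inv := fun _ => rfl }
    · ext x
      have : x = 0 := Subsingleton.elim (α := V.carrier ⊗[R] PUnit.{u+1}) _ _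
      rw [this, map_zero, map_zero]
  smul_add := by
    rintro ⟨V⟩ ⟨W⟩ ⟨U⟩
    obtain ⟨a, ha⟩ := LinearMap.BilinMap.toQuadraticMap_surjective W.form
    obtain ⟨b, hb⟩ := LinearMap.BilinMap.toQuadraticMap_surjective U.form
    refine Quotient.sound (isometric_of (V := tensor V (W.add U))
      (W := (tensor V W).add (tensor V U)) (TensorProduct.prodRight R R _ _ _) ?_)
    rw [add_form, tensor_form, tensor_form, tensor_form, tensorForm_eq V.symm ((prod_toQuadraticMap a b).trans (by rw [ha, hb])),
      tensorForm_eq V.symm ha, tensorForm_eq V.symm hb, ← prod_toQuadraticMap]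
    refine toQuadraticMap_comp_eq _ _ _ ?_
    ext <;> simp
  add_smul := by
    rintro ⟨V⟩ ⟨W⟩ ⟨U⟩
    obtain ⟨a, ha⟩ := LinearMap.BilinMap.toQuadraticMap_surjective U.form
    refine Quotient.sound (isometric_of (V := tensor (V.add W) U)
      (W := (tensor V U).add (tensor W U)) (TensorProduct.prodLeft R R _ _ _) ?_)
    rw [add_form, tensor_form, tensor_form, tensor_form, tensorForm_eq (V.add W).symm ha,
      tensorForm_eq V.symm ha, tensorForm_eq W.symm ha, ← prod_toQuadraticMap]
    refine toQuadraticMap_comp_eq _ _ _ ?_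
    ext <;> simp
  zero_smul := by
    rintro ⟨V⟩
    refine Quotient.sound (isometric_of (V := tensor (BilinSpace.zero R) V) (W := zero R) ?_ ?_)
    · exact { (0 : (PUnit.{u+1} ⊗[R] V.carrier) →ₗ[R] PUnit.{u+1}) with
        invFun := fun _ => 0
        left_inv := fun x => Subsingleton.elim (α := PUnit.{u+1} ⊗[R] V.carrier) _ _
        right_inv := fun _ => rfl }
    · ext x
      have : x = 0 := Subsingleton.elim (α := PUnit.{u+1} ⊗[R] V.carrier) _ _
      rw [this, map_zero, map_zero]

/-- Witt equivalence of isometry classes: equality after adding hyperbolic spaces. -/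
def wittCon (R : Type u) [CommRing R] : AddCon (IsoClass R) where
  r x y := ∃ M N : QuadSpace R, M.IsHyperbolic ∧ N.IsHyperbolic ∧
    x + M.isoClass = y + N.isoClass
  iseqv := by
    refine ⟨fun x => ⟨zero R, zero R, isHyperbolic_zero, isHyperbolic_zero, rfl⟩, ?_, ?_⟩
    · rintro x y ⟨M, N, hM, hN, h⟩
      exact ⟨N, M, hN, hM, h.symm⟩
    · rintro x y z ⟨M, N, hM, hN, h⟩ ⟨M', N', hM', hN', h'⟩
      refine ⟨M.add M', N'.add N, hM.add hM', hN'.add hN, ?_⟩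
      rw [isoClass_add, isoClass_add, ← add_assoc, h, add_right_comm, h', add_assoc]
  add' := by
    rintro x y z t ⟨M, N, hM, hN, h⟩ ⟨M', N', hM', hN', h'⟩
    refine ⟨M.add M', N.add N', hM.add hM', hN.add hN', ?_⟩
    rw [isoClass_add, isoClass_add, add_add_add_comm, h, h', add_add_add_comm]

lemma wittCon_smul {b b' : BilinSpace.IsoClass R} {x x' : IsoClass R}
    (hb : BilinSpace.wittCon R b b') (hx : wittCon R x x') :
    wittCon R (b • x) (b' • x') := by
  obtain ⟨V, rfl⟩ := BilinSpace.exists_isoClass_eq b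
  obtain ⟨V', rfl⟩ := BilinSpace.exists_isoClass_eq b'
  obtain ⟨W, rfl⟩ := exists_isoClass_eq x
  obtain ⟨W', rfl⟩ := exists_isoClass_eq x'
  obtain ⟨M, N, hM, hN, h⟩ := hb
  obtain ⟨P, Q, hP, hQ, h'⟩ := hx
  refine ⟨((tensor V P).add (tensor M W)).add (tensor M P),
    ((tensor V' Q).add (tensor N W')).add (tensor N Q),
    ((hP.tensor V).add (isHyperbolic_tensor_of_isMetabolic hM W)).add (hP.tensor M),
    ((hQ.tensor V').add (isHyperbolic_tensor_of_isMetabolic hN W')).add (hQ.tensor N), ?_⟩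
  have := congrArg₂ (· • ·) h h'
  simp only [add_smul, smul_add] at this
  simp only [isoClass_add, isoClass_tensor]
  simpa only [add_assoc, add_comm, add_left_comm] using this

end QuadSpace

/-- The Witt group of nonsingular quadratic spaces over `R`. -/
def QuadWittGroup (R : Type u) [CommRing R] : Type (u + 1) := (QuadSpace.wittCon R).Quotient

/-- The class of a nonsingular quadratic space in the Witt group. -/
def QuadSpace.wittClass {R : Type u} [CommRing R] (V : QuadSpace R) : QuadWittGroup R :=
  AddCon.toQuotient (c := QuadSpace.wittCon R) V.isoClass

namespace QuadWittGroup

open QuadSpace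

variable {R : Type u} [CommRing R]

instance : AddCommMonoid (QuadWittGroup R) :=
  inferInstanceAs (AddCommMonoid (QuadSpace.wittCon R).Quotient)

lemma exists_wittClass_eq (x : QuadWittGroup R) : ∃ V : QuadSpace R, V.wittClass = x := by
  obtain ⟨y, rfl⟩ := Quotient.exists_rep x
  obtain ⟨V, rfl⟩ := exists_isoClass_eq y
  exact ⟨V, rfl⟩

lemma wittClass_eq_iff {V W : QuadSpace R} : V.wittClass = W.wittClass ↔
    ∃ M N : QuadSpace R, M.IsHyperbolic ∧ N.IsHyperbolic ∧ (V.add M).Isometric (W.add N) := by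
  have h : V.wittClass = W.wittClass ↔ wittCon R V.isoClass W.isoClass := (wittCon R).eq
  rw [h]
  refine ⟨?_, ?_⟩
  · rintro ⟨M, N, hM, hN, h⟩
    exact ⟨M, N, hM, hN, isoClass_eq_iff.1 h⟩
  · rintro ⟨M, N, hM, hN, h⟩
    exact ⟨M, N, hM, hN, isoClass_eq_iff.2 h⟩

lemma wittClass_add (V W : QuadSpace R) : (V.add W).wittClass = V.wittClass + W.wittClass := rfl

lemma wittClass_zero : (zero R).wittClass = 0 := rfl

lemma wittClass_add_neg (V : QuadSpace R) : V.wittClass + V.neg.wittClass = 0 := by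
  rw [← wittClass_zero, ← wittClass_add, wittClass_eq_iff]
  exact ⟨zero R, _, isHyperbolic_zero, V.isHyperbolic_add_neg,
    isoClass_eq_iff.1 (add_comm (V.add V.neg).isoClass (zero R).isoClass)⟩

lemma neg_well_defined {V W : QuadSpace R} (h : V.wittClass = W.wittClass) :
    V.neg.wittClass = W.neg.wittClass := by
  calc V.neg.wittClass = V.neg.wittClass + (W.wittClass + W.neg.wittClass) := by
        rw [wittClass_add_neg, add_zero]
    _ = (V.wittClass + V.neg.wittClass) + W.neg.wittClass := by
        rw [h, ← add_assoc, add_comm V.neg.wittClass]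
    _ = _ := by rw [wittClass_add_neg, zero_add]

instance : Neg (QuadWittGroup R) where
  neg x := (exists_wittClass_eq x).choose.neg.wittClass

lemma neg_wittClass (V : QuadSpace R) : -V.wittClass = V.neg.wittClass :=
  neg_well_defined (exists_wittClass_eq V.wittClass).choose_spec

instance : AddCommGroup (QuadWittGroup R) where
  zsmul := zsmulRec
  neg_add_cancel x := by
    obtain ⟨V, rfl⟩ := exists_wittClass_eq x
    rw [neg_wittClass, add_comm, wittClass_add_neg]

instance : SMul (WittRing R) (QuadWittGroup R) where
  smul := Quotient.map₂ (· • ·) fun _ _ h _ _ h' => wittCon_smul h h'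

lemma wittClass_tensor (V : BilinSpace R) (W : QuadSpace R) :
    (tensor V W).wittClass = V.wittClass • W.wittClass := rfl

instance : Module (WittRing R) (QuadWittGroup R) where
  one_smul := by
    rintro ⟨x⟩
    exact congrArg (AddCon.toQuotient (c := wittCon R)) (one_smul (BilinSpace.IsoClass R) x)
  mul_smul := by
    rintro ⟨b⟩ ⟨c⟩ ⟨x⟩
    exact congrArg (AddCon.toQuotient (c := wittCon R)) (mul_smul (α := BilinSpace.IsoClass R) b c x)
  smul_zero := by
    rintro ⟨b⟩
    exact congrArg (AddCon.toQuotient (c := wittCon R))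
      (smul_zero (A := IsoClass R) (b : BilinSpace.IsoClass R))
  smul_add := by
    rintro ⟨b⟩ ⟨x⟩ ⟨y⟩
    exact congrArg (AddCon.toQuotient (c := wittCon R))
      (smul_add (b : BilinSpace.IsoClass R) (x : IsoClass R) y)
  add_smul := by
    rintro ⟨b⟩ ⟨c⟩ ⟨x⟩
    exact congrArg (AddCon.toQuotient (c := wittCon R))
      (add_smul (b : BilinSpace.IsoClass R) c (x : IsoClass R))
  zero_smul := by
    rintro ⟨x⟩
    exact congrArg (AddCon.toQuotient (c := wittCon R)) (zero_smul (BilinSpace.IsoClass R) x)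

end QuadWittGroup

namespace QuadSpace

variable {R : Type u} [CommRing R]

section baseChangeForm

variable (S : Type u) [CommRing S] [Algebra R S] {V : Type u} [AddCommGroup V] [Module R V]
  [Module.Free R V]

/-- The base change of a quadratic form on a free module: `z ↦ a_S(z, z)` where `a_S` is the base
change of any bilinear form `a` with `a(v, v) = q(v)`. It is the quadratic form with
value `s² q(v)` at `s ⊗ v` and with polar form the base change of that of `q`. -/
def baseChangeForm (q : QuadraticForm R V) : QuadraticForm S (S ⊗[R] V) :=
  (LinearMap.BilinForm.baseChange S
    (LinearMap.BilinMap.toQuadraticMap_surjective q).choose).toQuadraticMap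

lemma baseChangeForm_tmul (q : QuadraticForm R V) (s : S) (v : V) :
    baseChangeForm S q (s ⊗ₜ v) = s * s * algebraMap R S (q v) := by
  have h := (LinearMap.BilinMap.toQuadraticMap_surjective q).choose_spec
  have h1 := DFunLike.congr_fun h v
  simp only [LinearMap.BilinMap.toQuadraticMap_apply] at h1
  simp [baseChangeForm, h1, Algebra.smul_def, mul_comm]

lemma polarBilin_baseChangeForm (q : QuadraticForm R V) :
    (baseChangeForm S q).polarBilin = LinearMap.BilinForm.baseChange S q.polarBilin := by
  have h := (LinearMap.BilinMap.toQuadraticMap_surjective q).choose_spec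
  conv_rhs => rw [← h]
  rw [baseChangeForm]
  ext v w
  simp [LinearMap.BilinMap.polar_toQuadraticMap, add_smul]

end baseChangeForm

/-- The base change of a quadratic space along `R → S`. -/
abbrev baseChange (S : Type u) [CommRing S] [Algebra R S] (V : QuadSpace R) : QuadSpace S where
  carrier := S ⊗[R] V.carrier
  form := baseChangeForm S V.form
  unimodular := by
    have ibc : IsBaseChange S (TensorProduct.mk R S V.carrier 1) :=
      TensorProduct.isBaseChange R V.carrier S
    have h : LinearMap.BilinForm.baseChange S V.form.polarBilin =
        ((LinearEquiv.baseChange R S _ _ (.ofBijective V.form.polarBilin V.unimodular)) ≪≫ₗ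
          ibc.toDualBaseChange).toLinearMap := by
      ext v w
      have := ibc.toDualBaseChange_tmul 1 (V.form.polarBilin v) w
      simp only [TensorProduct.mk_apply] at this
      simp [this, Algebra.smul_def]
    rw [polarBilin_baseChangeForm, h]
    exact LinearEquiv.bijective _

end QuadSpace

end

/-!
All forms over the residue field `F` lift to `A` by lifting Gram matrices
(`BilinSpace.exists_isLift`, `QuadSpace.exists_isLift`), and lifts are compatible with orthogonal
sums and tensor products. A Witt class in `IⁿF ⊗ W_q(F)` is a sum of products `x q`, where `x` lifts
to a class in `IⁿA`, as even rank is preserved by lifting, and `q` lifts to a nonsingular quadratic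
space over `A`. The polar form of the lift of `q` has even rank, because `2` is not a unit in `A`
(`QuadSpace.even_finrank`). So the product of the lifts has polar form in `Iⁿ⁺¹A`: this is the gain
of one power of the fundamental ideal (`QuadSpace.exists_isLift_of_wittClass_mem`).

This gives a lift of some space Witt equivalent to `ψ`. To reach `ψ` itself, add hyperbolic spaces
until the lift reduces to `ψ ⊥ N` with `N` hyperbolic, and then remove the hyperbolic planes of `N`
one at a time. By Hensel's lemma a hyperbolic pair in the reduction lifts to a hyperbolic pair over
`A` (`QuadSpace.exists_lift_hyperbolicPair`); the orthogonal complement of the lifted pair reduces to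
the orthogonal complement of the given one and has a polar form of the same Witt class
(`QuadSpace.IsLift.cancel_hyperbolicPlane`). No Witt cancellation over `F` is needed, and the
reduction is isometric to `ψ` for every `n`.

Reductions are handled through the relation `IsLift`, a surjective semilinear map compatible with
the forms, instead of base change; `QuadSpace.IsLift.isometric_baseChange` relates the two.
-/

/-! ### Unimodularity and determinants -/

namespace LinearMap.BilinForm

/-- A bilinear form on a free module is unimodular if and only if its Gram determinant is a unit. -/
theorem bijective_iff_isUnit_det {R V ι : Type*} [CommRing R] [AddCommGroup V] [Module R V]
    [Fintype ι] [DecidableEq ι] (b : Module.Basis ι R V) (c : LinearMap.BilinForm R V) :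
    Function.Bijective c ↔ IsUnit (LinearMap.BilinForm.toMatrix b c).det := by
  have h : LinearMap.toMatrix b b.dualBasis c = (LinearMap.BilinForm.toMatrix b c).transpose := by
    ext i j
    simp [LinearMap.toMatrix_apply, LinearMap.BilinForm.toMatrix_apply]
  rw [← Matrix.det_transpose, ← h]
  constructor
  · intro hc
    exact LinearEquiv.isUnit_det (LinearEquiv.ofBijective c hc) b b.dualBasis
  · intro hc
    exact (LinearEquiv.ofIsUnitDet hc).bijective

end LinearMap.BilinForm

/-- If `2` is a nonunit of a local domain of characteristic zero, nonsingular quadratic spaces have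
even rank: the Gram matrix `N + Nᵀ` of the polar form agrees modulo `2` with the skew-symmetric
matrix `N - Nᵀ`, whose determinant vanishes in odd size. -/
theorem QuadSpace.even_finrank {A : Type u} [CommRing A] [IsDomain A] [IsLocalRing A] [CharZero A]
    (h2 : (2 : A) ∈ IsLocalRing.maximalIdeal A) (V : QuadSpace A) :
    Even (Module.finrank A V.carrier) := by
  by_contra hodd
  rw [Nat.not_even_iff_odd] at hodd
  obtain ⟨a, ha⟩ := LinearMap.BilinMap.toQuadraticMap_surjective V.form
  let b := Module.finBasis A V.carrier
  let N := LinearMap.BilinForm.toMatrix b a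
  have hpol : LinearMap.BilinForm.toMatrix b V.form.polarBilin = N + N.transpose := by
    ext i j
    simp [N, LinearMap.BilinForm.toMatrix_apply, ← ha, LinearMap.BilinMap.polar_toQuadraticMap]
  have hu : IsUnit (N + N.transpose).det := by
    rw [← hpol]
    exact (LinearMap.BilinForm.bijective_iff_isUnit_det b _).1 V.unimodular
  have hskew : (N - N.transpose).det = 0 := by
    have h1 : (N - N.transpose).det = -(N - N.transpose).det := by
      conv_lhs => rw [← Matrix.det_transpose, Matrix.transpose_sub, Matrix.transpose_transpose,
        ← neg_sub, Matrix.det_neg, Fintype.card_fin, hodd.neg_one_pow, neg_one_mul]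
    exact self_eq_neg.1 h1
  have hres : (IsLocalRing.residue A).mapMatrix (N + N.transpose) =
      (IsLocalRing.residue A).mapMatrix (N - N.transpose) := by
    have h2' : IsLocalRing.residue A 2 = 0 := (IsLocalRing.residue_eq_zero_iff 2).2 h2
    ext i j
    simp only [RingHom.mapMatrix_apply, Matrix.map_apply, Matrix.add_apply, Matrix.sub_apply,
      Matrix.transpose_apply, map_add, map_sub]
    rw [map_ofNat] at h2'
    linear_combination (IsLocalRing.residue A (N j i)) * h2'
  have h3 : IsLocalRing.residue A (N + N.transpose).det = 0 := by
    rw [RingHom.map_det, hres, ← RingHom.map_det, hskew, map_zero]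
  exact (hu.map (IsLocalRing.residue A)).ne_zero h3

/-! ### Lifts of spaces over the residue field -/

section lifts

variable {A : Type u} [CommRing A] [IsLocalRing A]

/-- `V` is a lift of `W`: there is a surjective semilinear map `V → W` along the residue map which
is compatible with the forms. Equivalently, `W` is isometric to the reduction of `V`. -/
def BilinSpace.IsLift (V : BilinSpace A) (W : BilinSpace (IsLocalRing.ResidueField A)) : Prop :=
  ∃ π : V.carrier →ₛₗ[IsLocalRing.residue A] W.carrier, Function.Surjective π ∧
    ∀ v w, W.form (π v) (π w) = IsLocalRing.residue A (V.form v w)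

/-- `V` is a lift of `W`: there is a surjective semilinear map `V → W` along the residue map which
is compatible with the forms. Equivalently, `W` is isometric to the reduction of `V`, see
`QuadSpace.IsLift.isometric_baseChange`. -/
def QuadSpace.IsLift (V : QuadSpace A) (W : QuadSpace (IsLocalRing.ResidueField A)) : Prop :=
  ∃ π : V.carrier →ₛₗ[IsLocalRing.residue A] W.carrier, Function.Surjective π ∧
    ∀ v, W.form (π v) = IsLocalRing.residue A (V.form v)

theorem LinearMap.surjective_tensorProductMap {R S : Type*} [CommRing R] [CommRing S] {σ : R →+* S}
    {V W V' W' : Type*} [AddCommGroup V] [Module R V] [AddCommGroup W] [Module R W]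
    [AddCommGroup V'] [Module S V'] [AddCommGroup W'] [Module S W']
    {f : V →ₛₗ[σ] V'} {g : W →ₛₗ[σ] W'} (hf : Function.Surjective f) (hg : Function.Surjective g) :
    Function.Surjective (TensorProduct.map f g) := by
  intro z
  induction z with
  | zero => exact ⟨0, map_zero _⟩
  | tmul x y =>
    obtain ⟨v, rfl⟩ := hf x
    obtain ⟨w, rfl⟩ := hg y
    exact ⟨v ⊗ₜ w, TensorProduct.map_tmul _ _ _ _⟩
  | add x y hx hy =>
    obtain ⟨v, rfl⟩ := hx
    obtain ⟨w, rfl⟩ := hy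
    exact ⟨v + w, map_add _ _ _⟩

theorem LinearMap.BilinForm.tmul_map_map {R S : Type*} [CommRing R] [CommRing S] {σ : R →+* S}
    {V W V' W' : Type*} [AddCommGroup V] [Module R V] [AddCommGroup W] [Module R W]
    [AddCommGroup V'] [Module S V'] [AddCommGroup W'] [Module S W']
    {f : V →ₛₗ[σ] V'} {g : W →ₛₗ[σ] W'}
    {b : LinearMap.BilinForm R V} {c : LinearMap.BilinForm R W}
    {b' : LinearMap.BilinForm S V'} {c' : LinearMap.BilinForm S W'}
    (hb : ∀ x y, b' (f x) (f y) = σ (b x y)) (hc : ∀ x y, c' (g x) (g y) = σ (c x y))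
    (x y : V ⊗[R] W) :
    LinearMap.BilinForm.tmul b' c' (TensorProduct.map f g x) (TensorProduct.map f g y) =
      σ (LinearMap.BilinForm.tmul b c x y) := by
  induction x with
  | zero => simp
  | add x₁ x₂ h₁ h₂ => simp only [map_add, LinearMap.add_apply, h₁, h₂]
  | tmul v w =>
    induction y with
    | zero => simp
    | add y₁ y₂ h₁ h₂ => simp only [map_add, h₁, h₂]
    | tmul v' w' => simp [hb, hc]

namespace BilinSpace.IsLift

variable {V V' : BilinSpace A} {W W' : BilinSpace (IsLocalRing.ResidueField A)}

theorem add (h : V.IsLift W) (h' : V'.IsLift W') : (V.add V').IsLift (W.add W') := by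
  obtain ⟨π, hπ, hf⟩ := h
  obtain ⟨π', hπ', hf'⟩ := h'
  exact ⟨{ toFun := Prod.map π π'
           map_add' := fun x y => Prod.ext (map_add π _ _) (map_add π' _ _)
           map_smul' := fun a x => Prod.ext (map_smulₛₗ π _ _) (map_smulₛₗ π' _ _) },
    hπ.prodMap hπ', fun v w => by simp [BilinSpace.add, hf, hf']⟩

theorem mul (h : V.IsLift W) (h' : V'.IsLift W') : (V.mul V').IsLift (W.mul W') := by
  obtain ⟨π, hπ, hf⟩ := h
  obtain ⟨π', hπ', hf'⟩ := h'
  exact ⟨TensorProduct.map π π',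
    LinearMap.surjective_tensorProductMap hπ hπ',
    LinearMap.BilinForm.tmul_map_map hf hf'⟩

end BilinSpace.IsLift

theorem BilinSpace.isLift_zero :
    (BilinSpace.zero A).IsLift (BilinSpace.zero (IsLocalRing.ResidueField A)) :=
  ⟨{ toFun := id, map_add' := fun _ _ => rfl, map_smul' := fun _ _ => rfl },
    Function.surjective_id, fun _ _ => (map_zero _).symm⟩

/-- A basis of a space over the residue field presents it as the reduction of a standard free
module. -/
theorem exists_semilinearMap_single_eq_basis {V : Type*} [AddCommGroup V]
    [Module (IsLocalRing.ResidueField A) V] {ι : Type*} [Fintype ι] [DecidableEq ι]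
    (b : Module.Basis ι (IsLocalRing.ResidueField A) V) :
    ∃ π : (ι → A) →ₛₗ[IsLocalRing.residue A] V, Function.Surjective π ∧
      ∀ i, π (Pi.basisFun A ι i) = b i := by
  let π : (ι → A) →ₛₗ[IsLocalRing.residue A] V :=
    { toFun := fun x => b.equivFun.symm fun i => IsLocalRing.residue A (x i)
      map_add' := fun x y => by
        rw [← map_add]; congr 1
      map_smul' := fun a x => by
        rw [← map_smul]; congr 1 }
  refine ⟨π, ?_, ?_⟩
  · intro v
    choose x hx using fun i => IsLocalRing.residue_surjective (R := A) (b.equivFun v i)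
    refine ⟨x, ?_⟩
    change b.equivFun.symm (fun i => IsLocalRing.residue A (x i)) = v
    simp only [hx]
    exact b.equivFun.symm_apply_apply v
  · intro i
    change b.equivFun.symm (fun j => IsLocalRing.residue A (Pi.basisFun A ι i j)) = b i
    rw [LinearEquiv.symm_apply_eq]
    ext j
    by_cases h : j = i
    · subst h; simp
    · simp [h, Ne.symm h]

/-- Compatibility of bilinear forms with a semilinear map can be checked on a basis. -/
theorem LinearMap.BilinForm.map_eq_of_basis {R S V W ι : Type*} [CommRing R] [CommRing S]
    {σ : R →+* S} [AddCommGroup V] [Module R V] [AddCommGroup W] [Module S W]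
    (b : Module.Basis ι R V) (π : V →ₛₗ[σ] W)
    (c : LinearMap.BilinForm R V) (d : LinearMap.BilinForm S W)
    (h : ∀ i j, d (π (b i)) (π (b j)) = σ (c (b i) (b j))) (x y : V) :
    d (π x) (π y) = σ (c x y) := by
  have hx : x ∈ Submodule.span R (Set.range b) := b.mem_span x
  have hy : y ∈ Submodule.span R (Set.range b) := b.mem_span y
  induction hx, hy using Submodule.span_induction₂ with
  | mem_mem x y hx hy =>
    obtain ⟨i, rfl⟩ := hx
    obtain ⟨j, rfl⟩ := hy
    exact h i j
  | zero_left => simp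
  | zero_right => simp
  | add_left x y z _ _ _ h₁ h₂ => simp only [map_add, LinearMap.add_apply, h₁, h₂]
  | add_right x y z _ _ _ h₁ h₂ => simp only [map_add, h₁, h₂]
  | smul_left r x y _ _ h => simp [h]
  | smul_right r x y _ _ h => simp [h]

/-- A bilinear form which reduces to a unimodular form, basis to basis, is unimodular: its Gram
determinant is nonzero in the residue field. -/
theorem LinearMap.BilinForm.bijective_of_residue {V W ι : Type*} [AddCommGroup V] [Module A V]
    [AddCommGroup W] [Module (IsLocalRing.ResidueField A) W] [Fintype ι] [DecidableEq ι]
    (b : Module.Basis ι A V) (b' : Module.Basis ι (IsLocalRing.ResidueField A) W)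
    {c : LinearMap.BilinForm A V} {d : LinearMap.BilinForm (IsLocalRing.ResidueField A) W}
    (h : ∀ i j, d (b' i) (b' j) = IsLocalRing.residue A (c (b i) (b j)))
    (hd : Function.Bijective d) : Function.Bijective c := by
  rw [LinearMap.BilinForm.bijective_iff_isUnit_det b]
  rw [LinearMap.BilinForm.bijective_iff_isUnit_det b'] at hd
  have hM : LinearMap.BilinForm.toMatrix b' d =
      (IsLocalRing.residue A).mapMatrix (LinearMap.BilinForm.toMatrix b c) := by
    ext i j
    simp [LinearMap.BilinForm.toMatrix_apply, h]
  rw [hM, ← RingHom.map_det] at hd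
  exact isUnit_of_map_unit (IsLocalRing.residue A) _ hd

theorem BilinSpace.exists_isLift (W : BilinSpace (IsLocalRing.ResidueField A)) :
    ∃ V : BilinSpace A, V.IsLift W ∧ Module.finrank A V.carrier =
      Module.finrank (IsLocalRing.ResidueField A) W.carrier := by
  let b := Module.finBasis (IsLocalRing.ResidueField A) W.carrier
  obtain ⟨π, hπ, hb⟩ := exists_semilinearMap_single_eq_basis b
  -- A lift of the Gram matrix chosen as a function of the entry is symmetric.
  let s := Function.surjInv (IsLocalRing.residue_surjective (R := A))
  let c := Matrix.toBilin (Pi.basisFun A (Fin _)) (Matrix.of fun i j => s (W.form (b i) (b j)))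
  have hc : ∀ i j, c (Pi.basisFun A _ i) (Pi.basisFun A _ j) = s (W.form (b i) (b j)) := by
    intro i j
    rw [← LinearMap.BilinForm.toMatrix_apply, LinearMap.BilinForm.toMatrix_toBilin, Matrix.of_apply]
  have hs : ∀ x, IsLocalRing.residue A (s x) = x :=
    Function.surjInv_eq (IsLocalRing.residue_surjective (R := A))
  have hsymm : c = c.flip := LinearMap.BilinForm.ext_basis (Pi.basisFun A _) fun i j => by
    refine (hc i j).trans (Eq.trans ?_ (hc j i).symm)
    rw [W.symm.eq]
  refine ⟨⟨Fin _ → A, c, ⟨fun x y => LinearMap.congr_fun₂ hsymm x y⟩, ?_⟩, ⟨π, hπ, ?_⟩, ?_⟩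
  · refine LinearMap.BilinForm.bijective_of_residue (Pi.basisFun A _) b (fun i j => ?_) W.unimodular
    rw [hc, hs]
  · refine LinearMap.BilinForm.map_eq_of_basis (Pi.basisFun A _) π c W.form fun i j => ?_
    rw [hc, hs, hb, hb]
  · simp

namespace QuadSpace

variable {V V' : QuadSpace A} {W W' : QuadSpace (IsLocalRing.ResidueField A)}

theorem exists_isLift (W : QuadSpace (IsLocalRing.ResidueField A)) :
    ∃ V : QuadSpace A, V.IsLift W := by
  obtain ⟨a, ha⟩ := LinearMap.BilinMap.toQuadraticMap_surjective W.form
  let b := Module.finBasis (IsLocalRing.ResidueField A) W.carrier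
  obtain ⟨π, hπ, hb⟩ := exists_semilinearMap_single_eq_basis b
  choose s hs using IsLocalRing.residue_surjective (R := A)
  let c := Matrix.toBilin (Pi.basisFun A (Fin _)) (Matrix.of fun i j => s (a (b i) (b j)))
  have hc : ∀ i j, c (Pi.basisFun A _ i) (Pi.basisFun A _ j) = s (a (b i) (b j)) := by
    intro i j
    rw [← LinearMap.BilinForm.toMatrix_apply, LinearMap.BilinForm.toMatrix_toBilin, Matrix.of_apply]
  refine ⟨⟨Fin _ → A, c.toQuadraticMap, ?_⟩, ⟨π, hπ, ?_⟩⟩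
  · refine LinearMap.BilinForm.bijective_of_residue (Pi.basisFun A _) b (fun i j => ?_) W.unimodular
    simp only [QuadraticMap.polarBilin_apply_apply, LinearMap.BilinMap.polar_toQuadraticMap, ← ha,
      hc, map_add, hs]
  · intro v
    simp only [← ha, LinearMap.BilinMap.toQuadraticMap_apply]
    refine LinearMap.BilinForm.map_eq_of_basis (Pi.basisFun A _) π c a (fun i j => ?_) v v
    rw [hc, hs, hb, hb]

theorem IsLift.of_isometric (h : V.IsLift W) (hW : W.Isometric W') : V.IsLift W' := by
  obtain ⟨π, hπ, hf⟩ := h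
  obtain ⟨e, he⟩ := hW.exists_equiv
  refine ⟨e.toLinearMap.comp π, e.surjective.comp hπ, fun v => ?_⟩
  rw [← hf, ← he]
  rfl

theorem IsLift.add (h : V.IsLift W) (h' : V'.IsLift W') : (V.add V').IsLift (W.add W') := by
  obtain ⟨π, hπ, hf⟩ := h
  obtain ⟨π', hπ', hf'⟩ := h'
  exact ⟨{ toFun := Prod.map π π'
           map_add' := fun x y => Prod.ext (map_add π _ _) (map_add π' _ _)
           map_smul' := fun a x => Prod.ext (map_smulₛₗ π _ _) (map_smulₛₗ π' _ _) },
    hπ.prodMap hπ', fun v => by simp [QuadSpace.add, hf, hf']⟩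

theorem IsLift.neg (h : V.IsLift W) : V.neg.IsLift W.neg := by
  obtain ⟨π, hπ, hf⟩ := h
  exact ⟨π, hπ, fun v => by simp [QuadSpace.neg, hf]⟩

theorem polar_map {π : V.carrier →ₛₗ[IsLocalRing.residue A] W.carrier}
    (hf : ∀ v, W.form (π v) = IsLocalRing.residue A (V.form v)) (v w : V.carrier) :
    W.form.polarBilin (π v) (π w) = IsLocalRing.residue A (V.form.polarBilin v w) := by
  simp only [QuadraticMap.polarBilin_apply_apply, QuadraticMap.polar, ← map_add π, hf, map_sub]

theorem IsLift.tensor {U : BilinSpace A} {U' : BilinSpace (IsLocalRing.ResidueField A)}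
    (hU : U.IsLift U') (h : V.IsLift W) : (tensor U V).IsLift (tensor U' W) := by
  obtain ⟨ρ, hρ, hg⟩ := hU
  obtain ⟨π, hπ, hf⟩ := h
  refine ⟨TensorProduct.map ρ π,
    LinearMap.surjective_tensorProductMap hρ hπ, fun z => ?_⟩
  have hpol := LinearMap.BilinForm.tmul_map_map hg (polar_map hf)
  simp only [← polarBilin_tensorForm U.symm, ← polarBilin_tensorForm U'.symm] at hpol
  induction z using TensorProduct.induction_on with
  | zero => simp
  | tmul u v => rw [TensorProduct.map_tmul, tensorForm_tmul, tensorForm_tmul, hg, hf, map_mul]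
  | add x y hx hy =>
    rw [map_add, QuadraticMap.map_add (tensorForm U'.form W.form), hx, hy,
      QuadraticMap.map_add (tensorForm U.form V.form), map_add, map_add]
    exact congrArg _ (hpol x y)

/-- The reduction of a lift of `W` is isometric to `W`: the induced map from the reduction to `W`
is surjective, and injective since the reduction is nonsingular. -/
theorem IsLift.isometric_baseChange (h : V.IsLift W) :
    (V.baseChange (IsLocalRing.ResidueField A)).Isometric W := by
  obtain ⟨π, hπ, hf⟩ := h
  let V₀ := V.baseChange (IsLocalRing.ResidueField A)
  let _ : Module A W.carrier := Module.compHom W.carrier (IsLocalRing.residue A)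
  have : IsScalarTower A (IsLocalRing.ResidueField A) W.carrier :=
    ⟨fun a x w => by
      rw [Algebra.smul_def, mul_smul]; rfl⟩
  let π' : V.carrier →ₗ[A] W.carrier :=
    { toFun := π, map_add' := map_add π, map_smul' := fun a v => map_smulₛₗ π a v }
  let g : V₀.carrier →ₗ[IsLocalRing.ResidueField A] W.carrier :=
    LinearMap.liftBaseChange (IsLocalRing.ResidueField A) π'
  have hg : ∀ s v, g (s ⊗ₜ v) = s • π v := LinearMap.liftBaseChange_tmul _ π'
  have hpol : ∀ x y, W.form.polarBilin (g x) (g y) = V₀.form.polarBilin x y := by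
    have hV₀ : V₀.form.polarBilin = LinearMap.BilinForm.baseChange _ V.form.polarBilin :=
      polarBilin_baseChangeForm _ _
    intro x y
    rw [hV₀]
    induction x using TensorProduct.induction_on with
    | zero => simp
    | add x₁ x₂ h₁ h₂ => simp only [map_add, LinearMap.add_apply, h₁, h₂]
    | tmul s v =>
      induction y using TensorProduct.induction_on with
      | zero => simp
      | add y₁ y₂ h₁ h₂ => simp only [map_add, h₁, h₂]
      | tmul t w =>
        rw [hg, hg, map_smul, map_smul, LinearMap.smul_apply, polar_map hf,
          LinearMap.BilinForm.baseChange_tmul, smul_eq_mul, smul_eq_mul, Algebra.smul_def,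
          IsLocalRing.ResidueField.algebraMap_eq]
        ring
  have hform : ∀ x, W.form (g x) = V₀.form x := by
    intro x
    induction x using TensorProduct.induction_on with
    | zero => simp
    | tmul s v =>
      rw [hg, QuadraticMap.map_smul, hf]
      exact (baseChangeForm_tmul _ V.form s v).symm
    | add x y hx hy =>
      rw [map_add, QuadraticMap.map_add W.form, hx, hy, QuadraticMap.map_add V₀.form]
      exact congrArg _ (hpol x y)
  have hinj : Function.Injective g := by
    rw [injective_iff_map_eq_zero]
    intro x hx
    apply V₀.unimodular.1
    refine LinearMap.ext fun y => ?_
    rw [← hpol, hx, map_zero, map_zero]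
    rfl
  have hsurj : Function.Surjective g := fun w => by
    obtain ⟨v, rfl⟩ := hπ w
    exact ⟨1 ⊗ₜ v, by rw [hg, one_smul]⟩
  exact isometric_of (V := V₀) (LinearEquiv.ofBijective g ⟨hinj, hsurj⟩) (QuadraticMap.ext hform)

end QuadSpace

end lifts

/-! ### Splitting off hyperbolic planes -/

theorem BilinSpace.Isometric.wittClass_eq {R : Type u} [CommRing R] {V W : BilinSpace R}
    (h : V.Isometric W) : V.wittClass = W.wittClass :=
  congrArg (RingCon.toQuotient (c := BilinSpace.wittCon R)) (BilinSpace.isoClass_eq_iff.2 h)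

namespace QuadSpace

/-- The hyperbolic plane: the form `(x, y) ↦ x y` on `R × R`. -/
noncomputable abbrev hyperbolicPlane (R : Type u) [CommRing R] : QuadSpace R where
  carrier := R × R
  form := QuadraticMap.linMulLin (LinearMap.fst R R R) (LinearMap.snd R R R)
  unimodular := by
    have h : ∀ x y : R × R, (QuadraticMap.linMulLin (LinearMap.fst R R R)
        (LinearMap.snd R R R)).polarBilin x y = x.1 * y.2 + x.2 * y.1 := fun x y => by
      simp only [QuadraticMap.polarBilin_apply_apply, QuadraticMap.polar,
        QuadraticMap.linMulLin_apply, LinearMap.fst_apply, LinearMap.snd_apply, Prod.fst_add,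
        Prod.snd_add]
      ring
    constructor
    · intro x y hxy
      refine Prod.ext ?_ ?_
      · simpa [h] using LinearMap.congr_fun hxy (0, 1)
      · simpa [h] using LinearMap.congr_fun hxy (1, 0)
    · intro f
      refine ⟨(f (0, 1), f (1, 0)), LinearMap.ext fun y => ?_⟩
      have hy : y = y.1 • (1, 0) + y.2 • (0, 1) := by simp
      rw [h]
      conv_rhs => rw [hy, map_add, map_smul, map_smul]
      simp only [smul_eq_mul]
      ring

theorem hyperbolicPlane_equivalent_dualProd (R : Type u) [CommRing R] :
    (hyperbolicPlane R).form.Equivalent (QuadraticForm.dualProd R R) :=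
  ⟨{ (LinearMap.ringLmapEquivSelf R R R).symm.prodCongr (LinearEquiv.refl R R) with
    map_app' := fun x => by simp [mul_comm] }⟩

theorem isHyperbolic_hyperbolicPlane (R : Type u) [CommRing R] :
    (hyperbolicPlane R).IsHyperbolic :=
  ⟨R, _, _, inferInstance, inferInstance, hyperbolicPlane_equivalent_dualProd R⟩

variable {R : Type u} [CommRing R]

theorem IsHyperbolic.wittClass_polarSpace {V : QuadSpace R} (hV : V.IsHyperbolic) :
    V.polarSpace.wittClass = 0 := by
  obtain ⟨N, hN, -⟩ := hV.exists_isLagrangian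
  exact WittRing.wittClass_eq_zero_of_isMetabolic ⟨N, hN⟩

theorem Isometric.polarSpace {V W : QuadSpace R} (h : V.Isometric W) :
    V.polarSpace.Isometric W.polarSpace := by
  obtain ⟨e, he⟩ := h.exists_equiv
  refine BilinSpace.isometric_of (V := V.polarSpace) (W := W.polarSpace) e ?_
  rw [polarSpace_form, polarSpace_form, ← he]
  ext x y
  simp [QuadraticMap.polar]

theorem wittClass_polarSpace_add (V W : QuadSpace R) :
    (V.add W).polarSpace.wittClass = V.polarSpace.wittClass + W.polarSpace.wittClass := by
  rw [← WittRing.wittClass_add]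
  refine (BilinSpace.isometric_of (V := (V.add W).polarSpace)
    (W := V.polarSpace.add W.polarSpace) (.refl R (V.carrier × W.carrier)) ?_).wittClass_eq
  ext <;> simp

theorem wittClass_polarSpace_tensor (V : BilinSpace R) (W : QuadSpace R) :
    (tensor V W).polarSpace.wittClass = V.wittClass * W.polarSpace.wittClass := by
  rw [← WittRing.wittClass_mul]
  refine (BilinSpace.isometric_of (V := (tensor V W).polarSpace)
    (W := V.mul W.polarSpace) (.refl R (V.carrier ⊗[R] W.carrier)) ?_).wittClass_eq
  rw [polarSpace_form, tensor_form, polarBilin_tensorForm V.symm]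
  rfl

theorem IsHyperbolic.neg {V : QuadSpace R} (hV : V.IsHyperbolic) : V.neg.IsHyperbolic := by
  obtain ⟨N, ⟨hc, ho⟩, h0⟩ := hV.exists_isLagrangian
  refine isHyperbolic_of_isLagrangian (V := V.neg) (N := N) ⟨hc, ?_⟩ fun x hx => ?_
  · refine Eq.trans ?_ ho
    ext x
    refine forall₂_congr fun n _ => ?_
    change V.neg.form.polarBilin n x = 0 ↔ V.form.polarBilin n x = 0
    simp [QuadraticMap.polar_neg]
  · exact (congrArg Neg.neg (h0 x hx)).trans neg_zero

/-- A hyperbolic pair splits off a hyperbolic plane, with the orthogonal complement of the pair as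
the other summand. -/
theorem exists_equiv_add_hyperbolicPlane [IsDomain R] [IsPrincipalIdealRing R] (V : QuadSpace R)
    {x y : V.carrier} (hx : V.form x = 0) (hy : V.form y = 0) (hxy : V.form.polarBilin x y = 1) :
    ∃ (V' : QuadSpace R) (e : (V'.carrier × (R × R)) ≃ₗ[R] V.carrier),
      (∀ z, V.form (e z) = (V'.add (hyperbolicPlane R)).form z) ∧
      ∀ a b, e (0, (a, b)) = a • x + b • y := by
  let B := V.form.polarBilin
  have hs : ∀ v w, B v w = B w v := fun v w => QuadraticMap.polar_comm _ v w
  have hself : ∀ v, V.form v = 0 → B v v = 0 := fun v hv => by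
    simp [B, QuadraticMap.polar_self, hv]
  have hxx : B x x = 0 := hself x hx
  have hyy : B y y = 0 := hself y hy
  have hxy : B x y = 1 := hxy
  have hyx : B y x = 1 := (hs y x).trans hxy
  let W : Submodule R V.carrier := LinearMap.ker (B x) ⊓ LinearMap.ker (B y)
  have hW : ∀ w : W, B x w = 0 ∧ B y w = 0 := fun w => w.2
  let p : V.carrier →ₗ[R] W := LinearMap.codRestrict W
    (LinearMap.id - (B y).smulRight x - (B x).smulRight y) fun v => by
      refine ⟨?_, ?_⟩ <;> simp [hxx, hyy, hxy, hyx]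
  have hp : ∀ v, (p v : V.carrier) = v - B y v • x - B x v • y := fun v => rfl
  have hpW : ∀ w : W, p w = w := fun w => Subtype.ext <| by simp [hp, hW w]
  have hpx : p x = 0 := Subtype.ext <| by simp [hp, hxx, hyx]
  have hpy : p y = 0 := Subtype.ext <| by simp [hp, hyy, hxy]
  have hBp : ∀ (w : W) v, B w v = B w (p v) := fun w v => by
    simp [hp, hs w x, hs w y, hW w]
  let e : (W × (R × R)) ≃ₗ[R] V.carrier := LinearEquiv.ofLinearMap
    (LinearMap.coprod W.subtype (LinearMap.coprod (LinearMap.toSpanSingleton R _ x)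
      (LinearMap.toSpanSingleton R _ y)))
    (p.prod ((B y).prod (B x)))
    (LinearMap.ext fun v => by simp [hp])
    (LinearMap.ext fun ⟨w, a, b⟩ => by
      simp [hpW, hpx, hpy, hW w, hxx, hyy, hxy, hyx])
  have he : ∀ (w : W) a b, e (w, (a, b)) = w + (a • x + b • y) := fun w a b => rfl
  refine ⟨⟨W, V.form.comp W.subtype, ?_⟩, e, ?_, ?_⟩
  · have hB : ∀ w w' : W, (V.form.comp W.subtype).polarBilin w w' = B w w' := fun w w' => by
      simp [B, QuadraticMap.polar]
    constructor
    · rw [injective_iff_map_eq_zero]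
      intro w hw
      refine Subtype.ext (V.unimodular.1 (LinearMap.ext fun v => ?_))
      refine (hBp w v).trans ?_
      rw [← hB, hw]
      simp
    · intro f
      obtain ⟨v, hv⟩ := V.unimodular.2 (f ∘ₗ p)
      have hv : ∀ z, B v z = f (p z) := LinearMap.congr_fun hv
      have hvW : v ∈ W := ⟨LinearMap.mem_ker.2 (by rw [hs, hv, hpx, map_zero]),
        LinearMap.mem_ker.2 (by rw [hs, hv, hpy, map_zero])⟩
      refine ⟨⟨v, hvW⟩, LinearMap.ext fun w => ?_⟩
      rw [hB, hv, hpW]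
  · rintro ⟨w, a, b⟩
    have h1 : V.form (a • x + b • y) = a * b := by
      have := hxy
      simp only [B, QuadraticMap.polarBilin_apply_apply] at this
      rw [QuadraticMap.map_add V.form, QuadraticMap.map_smul, QuadraticMap.map_smul, hx, hy,
        QuadraticMap.polar_smul_left, QuadraticMap.polar_smul_right, this]
      simp
    have h2 : QuadraticMap.polar V.form w (a • x + b • y) = 0 := by
      change B w (a • x + b • y) = 0
      simp [hs w x, hs w y, hW w]
    rw [he, QuadraticMap.map_add V.form, h1, h2, add_zero]
    simp
  · intro a b
    rw [he]
    simp

end QuadSpace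

section lifts

variable {A : Type u} [CommRing A]

/-- Hensel's lemma for a quadratic equation `a t² + u t + c = 0` with `u` a unit and `c` in the
maximal ideal, which need not be monic. -/
theorem HenselianLocalRing.exists_root_quadratic [HenselianLocalRing A] {a u c : A} (hu : IsUnit u)
    (hc : c ∈ IsLocalRing.maximalIdeal A) :
    ∃ t ∈ IsLocalRing.maximalIdeal A, a * t ^ 2 + u * t + c = 0 := by
  open Polynomial in
  -- With `t = -c / w` the equation becomes the monic equation `w² - u w + a c = 0`, which has the
  -- simple root `u` modulo the maximal ideal.
  obtain ⟨w, hw, hwu⟩ := HenselianLocalRing.is_henselian (X ^ 2 - C u * X + C (a * c) : A[X])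
    (by monicity!) u (by
      have : (X ^ 2 - C u * X + C (a * c) : A[X]).eval u = a * c := by simp; ring
      rw [this]
      exact Ideal.mul_mem_left _ _ hc) (by
      have : (X ^ 2 - C u * X + C (a * c) : A[X]).derivative.eval u = u := by simp; ring
      rwa [this])
  have hw1 : IsUnit w := by
    by_contra h
    have h1 : w ∈ IsLocalRing.maximalIdeal A := h
    have h2 := Ideal.sub_mem _ h1 hwu
    rw [sub_sub_cancel] at h2
    exact h2 hu
  obtain ⟨v, hv⟩ := hw1.exists_right_inv
  have hw' : w ^ 2 - u * w + a * c = 0 := by simpa using hw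
  refine ⟨-c * v, Ideal.mul_mem_right _ _ (neg_mem hc), ?_⟩
  linear_combination (c * v ^ 2) * hw' + (-c * v * w - c + u * c * v) * hv

namespace QuadSpace

/-- Over a Henselian local ring hyperbolic pairs can be lifted along a reduction. -/
theorem exists_lift_hyperbolicPair [HenselianLocalRing A] {V : QuadSpace A}
    {W : QuadSpace (IsLocalRing.ResidueField A)}
    {π : V.carrier →ₛₗ[IsLocalRing.residue A] W.carrier} (hπ : Function.Surjective π)
    (hf : ∀ v, W.form (π v) = IsLocalRing.residue A (V.form v)) {x y : W.carrier}
    (hx : W.form x = 0) (hy : W.form y = 0) (hxy : W.form.polarBilin x y = 1) :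
    ∃ x' y', π x' = x ∧ π y' = y ∧ V.form x' = 0 ∧ V.form y' = 0 ∧
      V.form.polarBilin x' y' = 1 := by
  obtain ⟨v, rfl⟩ := hπ x
  obtain ⟨w, rfl⟩ := hπ y
  have hvw := (polar_map hf v w).symm.trans hxy
  rw [hf, IsLocalRing.residue_eq_zero_iff] at hx hy
  have hu : IsUnit (V.form.polarBilin v w) :=
    isUnit_of_map_unit (IsLocalRing.residue A) _ (by rw [hvw]; exact isUnit_one)
  obtain ⟨t, ht, h0⟩ := HenselianLocalRing.exists_root_quadratic (a := V.form w) hu hx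
  have ht' := (IsLocalRing.residue_eq_zero_iff t).2 ht
  have hx' : π (v + t • w) = π v := by rw [map_add, map_smulₛₗ, ht', zero_smul, add_zero]
  have hq : V.form (v + t • w) = 0 := by
    rw [QuadraticMap.map_add V.form, QuadraticMap.map_smul, QuadraticMap.polar_smul_right,
      ← h0, QuadraticMap.polarBilin_apply_apply]
    simp only [smul_eq_mul]
    ring
  generalize v + t • w = x' at hx' hq
  have hb : IsLocalRing.residue A (V.form.polarBilin x' w) = 1 := by
    rw [← polar_map hf, hx', polar_map hf, hvw]
  have hu' : IsUnit (V.form.polarBilin x' w) :=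
    isUnit_of_map_unit (IsLocalRing.residue A) _ (by rw [hb]; exact isUnit_one)
  obtain ⟨r, hr⟩ := hu'.exists_right_inv
  have hr' : IsLocalRing.residue A r = 1 := by
    have := congrArg (IsLocalRing.residue A) hr
    rwa [map_mul, hb, one_mul, map_one] at this
  have hxx : V.form.polarBilin x' x' = 0 := by simp [QuadraticMap.polar_self, hq]
  -- Rescale `w` to pair to `1` with `x'`, then subtract the multiple of `x'` making it isotropic.
  refine ⟨x', r • w - (r ^ 2 * V.form w) • x', hx', ?_, hq, ?_, ?_⟩
  · have hs : IsLocalRing.residue A (r ^ 2 * V.form w) = 0 := by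
      rw [map_mul, (IsLocalRing.residue_eq_zero_iff _).2 hy, mul_zero]
    rw [map_sub, map_smulₛₗ, map_smulₛₗ, hr', hs, one_smul, zero_smul, sub_zero]
  · rw [sub_eq_add_neg, ← neg_smul, QuadraticMap.map_add V.form, QuadraticMap.map_smul,
      QuadraticMap.map_smul, hq, QuadraticMap.polar_smul_left, QuadraticMap.polar_smul_right,
      QuadraticMap.polar_comm, ← QuadraticMap.polarBilin_apply_apply]
    simp only [smul_eq_mul]
    linear_combination (-(r ^ 2) * V.form w) * hr
  · rw [map_sub, map_smul, map_smul, hxx, smul_eq_mul, smul_zero, sub_zero, mul_comm, hr]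

variable [IsDomain A] [IsPrincipalIdealRing A] [HenselianLocalRing A]

/-- Cancellation of a hyperbolic plane in the reduction, by lifting the hyperbolic plane. -/
theorem IsLift.cancel_hyperbolicPlane {V : QuadSpace A}
    {W : QuadSpace (IsLocalRing.ResidueField A)}
    (h : V.IsLift (W.add (hyperbolicPlane (IsLocalRing.ResidueField A)))) :
    ∃ V' : QuadSpace A, V'.IsLift W ∧ V'.polarSpace.wittClass = V.polarSpace.wittClass := by
  obtain ⟨π, hπ, hf⟩ := h
  obtain ⟨x, y, hx, hy, hqx, hqy, hxy⟩ := exists_lift_hyperbolicPair hπ hf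
    (x := (0, (1, 0))) (y := (0, (0, 1))) (by simp) (by simp) (by simp [QuadraticMap.polar])
  obtain ⟨V', e, he, hexy⟩ := exists_equiv_add_hyperbolicPlane V hqx hqy hxy
  have hplane : ∀ a b, π (e (0, (a, b))) =
      (0, (IsLocalRing.residue A a, IsLocalRing.residue A b)) := fun a b => by
    rw [hexy, map_add, map_smulₛₗ, map_smulₛₗ, hx, hy]
    simp
  -- The complement of the lifted plane maps to the complement `W` of the plane.
  have horth : ∀ w, (π (e (w, 0))).2 = 0 := fun w => by
    have key : ∀ a b, (W.add (hyperbolicPlane _)).form.polarBilin (π (e (w, 0)))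
        (π (e (0, (a, b)))) = 0 := fun a b => by
      rw [polar_map hf, QuadraticMap.polarBilin_apply_apply, QuadraticMap.polar, ← map_add e, he,
        he, he]
      simp
    have h1 := key 1 0
    have h2 := key 0 1
    rw [hplane] at h1 h2
    generalize π (e (w, 0)) = z at h1 h2
    obtain ⟨z, a, b⟩ := z
    simp [QuadraticMap.polar, add_mul, mul_add] at h1 h2
    simp [h1, h2]
  refine ⟨V', ⟨{ toFun := fun w => (π (e (w, 0))).1, map_add' := ?_, map_smul' := ?_ }, ?_, ?_⟩, ?_⟩
  · intro v w
    rw [← Prod.fst_add, ← map_add, ← map_add, Prod.mk_add_mk, add_zero]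
  · intro a v
    rw [← Prod.smul_fst, ← map_smulₛₗ, ← map_smul, Prod.smul_mk, smul_zero]
  · intro w
    obtain ⟨v, hv⟩ := hπ (w, 0)
    obtain ⟨⟨v, a, b⟩, rfl⟩ := e.surjective v
    refine ⟨v, ?_⟩
    have h1 : ((v, (a, b)) : V'.carrier × (A × A)) = (v, 0) + (0, (a, b)) := by simp
    have h2 := congrArg Prod.fst hv
    rw [h1, map_add, map_add, hplane] at h2
    simpa using h2
  · intro v
    have h1 := hf (e (v, 0))
    rw [he] at h1
    have h2 : π (e (v, 0)) = ((π (e (v, 0))).1, 0) := Prod.ext rfl (horth v)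
    rw [h2] at h1
    simpa using h1
  · have hiso : (V'.add (hyperbolicPlane A)).Isometric V := isometric_of
      (V := V'.add (hyperbolicPlane A)) e (QuadraticMap.ext he)
    rw [← hiso.polarSpace.wittClass_eq, wittClass_polarSpace_add,
      (isHyperbolic_hyperbolicPlane A).wittClass_polarSpace, add_zero]

/-- Cancellation of a hyperbolic space in the reduction. -/
theorem IsLift.cancel_isHyperbolic {V : QuadSpace A}
    {W N : QuadSpace (IsLocalRing.ResidueField A)} (hN : N.IsHyperbolic) (h : V.IsLift (W.add N)) :
    ∃ V' : QuadSpace A, V'.IsLift W ∧ V'.polarSpace.wittClass = V.polarSpace.wittClass := by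
  have key : ∀ (k : ℕ) (W U : QuadSpace (IsLocalRing.ResidueField A)),
      U.form.Equivalent (W.form.prod (QuadraticForm.dualProd (IsLocalRing.ResidueField A)
        (Fin k → IsLocalRing.ResidueField A))) → V.IsLift U →
      ∃ V' : QuadSpace A, V'.IsLift W ∧ V'.polarSpace.wittClass = V.polarSpace.wittClass := by
    intro k
    induction k with
    | zero =>
      rintro W U hU hV
      refine ⟨V, hV.of_isometric (hU.trans ?_), rfl⟩
      exact ⟨{ toLinearEquiv := LinearEquiv.ofLinearMap (LinearMap.fst _ _ _) (LinearMap.inl _ _ _)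
                  (LinearMap.fst_comp_inl _ _ _)
                  (LinearMap.ext fun x => Prod.ext rfl (Subsingleton.elim _ _))
               map_app' := fun x => by
                have : x.2 = 0 := Subsingleton.elim _ _
                simp [this] }⟩
    | succ k ih =>
      rintro W U hU hV
      have e : (QuadraticForm.dualProd (IsLocalRing.ResidueField A)
          (Fin (k + 1) → IsLocalRing.ResidueField A)).Equivalent
          ((hyperbolicPlane (IsLocalRing.ResidueField A)).form.prod
            (QuadraticForm.dualProd (IsLocalRing.ResidueField A)
              (Fin k → IsLocalRing.ResidueField A))) :=
        (QuadraticMap.Equivalent.trans ⟨QuadraticForm.dualProdIsometry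
          (Fin.consLinearEquiv _ fun _ => IsLocalRing.ResidueField A).symm⟩
          ⟨QuadraticForm.dualProdProdIsometry⟩).trans
          (QuadraticMap.Equivalent.prod (hyperbolicPlane_equivalent_dualProd _).symm (.refl _))
      obtain ⟨V', hV', hV''⟩ := ih (W.add (hyperbolicPlane _)) U
        (hU.trans (((QuadraticMap.Equivalent.refl W.form).prod e).trans
          ⟨{ (LinearEquiv.prodAssoc (IsLocalRing.ResidueField A) _ _ _).symm with
            map_app' := fun x => add_assoc _ _ _ }⟩)) hV
      obtain ⟨V₁, h₁, h₂⟩ := IsLift.cancel_hyperbolicPlane hV'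
      exact ⟨V₁, h₁, h₂.trans hV''⟩
  obtain ⟨M, _, _, hf, _, hM⟩ := hN
  exact key (Module.finrank (IsLocalRing.ResidueField A) M) W (W.add N)
    ((QuadraticMap.Equivalent.refl W.form).prod (hM.trans
      ⟨QuadraticForm.dualProdIsometry (Module.finBasis _ M).equivFun⟩)) h

/-- Over a Henselian principal ideal domain, a lift of a space Witt equivalent to `W` can be
replaced by a lift of `W` itself without changing the Witt class of the polar form. -/
theorem IsLift.exists_of_wittClass_eq {V : QuadSpace A}
    {W W' : QuadSpace (IsLocalRing.ResidueField A)} (hV : V.IsLift W)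
    (hW : W.wittClass = W'.wittClass) :
    ∃ V' : QuadSpace A, V'.IsLift W' ∧ V'.polarSpace.wittClass = V.polarSpace.wittClass := by
  obtain ⟨M, N, hM, hN, hiso⟩ := QuadWittGroup.wittClass_eq_iff.1 hW
  obtain ⟨M', hM'⟩ := M.exists_isLift
  -- Adding `-M` on both sides makes the space added to `W` liftable to a hyperbolic space.
  have hiso' : (W.add (M.add M.neg)).Isometric (W'.add (N.add M.neg)) := by
    rw [← isoClass_eq_iff] at hiso ⊢
    simp only [isoClass_add] at hiso ⊢
    rw [← add_assoc, hiso, add_assoc]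
  obtain ⟨V', hV', h⟩ := IsLift.cancel_isHyperbolic (hN.add hM.neg)
    ((hV.add (hM'.add hM'.neg)).of_isometric hiso')
  refine ⟨V', hV', ?_⟩
  rw [h, wittClass_polarSpace_add, (isHyperbolic_add_neg M').wittClass_polarSpace, add_zero]

end QuadSpace

end lifts

/-! ### Lifting Witt classes -/

section wittClasses

variable {A : Type u} [CommRing A] [IsLocalRing A]

theorem BilinSpace.wittClass_mem_fundamentalIdeal {R : Type u} [CommRing R] {V : BilinSpace R}
    (h : Even (Module.finrank R V.carrier)) : V.wittClass ∈ WittRing.fundamentalIdeal R :=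
  Ideal.subset_span ⟨V, h, rfl⟩

/-- `x` is the class of a space having a lift with class `x'`. This is the relation `x = x̄'`,
without the well-definedness of the reduction map on Witt rings. -/
def WittRing.Lifts (x' : WittRing A) (x : WittRing (IsLocalRing.ResidueField A)) : Prop :=
  ∃ V : BilinSpace A, ∃ W : BilinSpace (IsLocalRing.ResidueField A),
    V.IsLift W ∧ V.wittClass = x' ∧ W.wittClass = x

namespace WittRing.Lifts

variable {x' y' : WittRing A} {x y : WittRing (IsLocalRing.ResidueField A)}

theorem zero : Lifts (0 : WittRing A) 0 := ⟨_, _, BilinSpace.isLift_zero, rfl, rfl⟩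

theorem add (hx : Lifts x' x) (hy : Lifts y' y) : Lifts (x' + y') (x + y) := by
  obtain ⟨V, W, h, rfl, rfl⟩ := hx
  obtain ⟨V₁, W₁, h₁, rfl, rfl⟩ := hy
  exact ⟨_, _, h.add h₁, rfl, rfl⟩

theorem mul (hx : Lifts x' x) (hy : Lifts y' y) : Lifts (x' * y') (x * y) := by
  obtain ⟨V, W, h, rfl, rfl⟩ := hx
  obtain ⟨V₁, W₁, h₁, rfl, rfl⟩ := hy
  exact ⟨_, _, h.mul h₁, rfl, rfl⟩

end WittRing.Lifts

namespace WittRing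

theorem exists_lifts (x : WittRing (IsLocalRing.ResidueField A)) : ∃ x' : WittRing A, x'.Lifts x := by
  obtain ⟨W, rfl⟩ := exists_wittClass_eq x
  obtain ⟨V, hV, -⟩ := W.exists_isLift
  exact ⟨_, V, W, hV, rfl, rfl⟩

theorem exists_lifts_of_mem_fundamentalIdeal {x : WittRing (IsLocalRing.ResidueField A)}
    (hx : x ∈ fundamentalIdeal (IsLocalRing.ResidueField A)) :
    ∃ x' ∈ fundamentalIdeal A, Lifts x' x := by
  induction hx using Submodule.span_induction with
  | mem x hx =>
    obtain ⟨W, hW, rfl⟩ := hx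
    obtain ⟨V, hV, hrank⟩ := W.exists_isLift
    exact ⟨V.wittClass, BilinSpace.wittClass_mem_fundamentalIdeal (by rwa [hrank]),
      V, W, hV, rfl, rfl⟩
  | zero => exact ⟨0, zero_mem _, .zero⟩
  | add x y _ _ hx hy =>
    obtain ⟨x', hx', hx⟩ := hx
    obtain ⟨y', hy', hy⟩ := hy
    exact ⟨x' + y', add_mem hx' hy', hx.add hy⟩
  | smul a x _ hx =>
    obtain ⟨a', ha⟩ := exists_lifts a
    obtain ⟨x', hx', hx⟩ := hx
    exact ⟨a' * x', Ideal.mul_mem_left _ _ hx', ha.mul hx⟩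

theorem exists_lifts_of_mem_fundamentalIdeal_pow (n : ℕ) :
    ∀ {x : WittRing (IsLocalRing.ResidueField A)},
      x ∈ fundamentalIdeal (IsLocalRing.ResidueField A) ^ n →
      ∃ x' ∈ fundamentalIdeal A ^ n, Lifts x' x := by
  induction n with
  | zero =>
    intro x _
    obtain ⟨x', hx'⟩ := exists_lifts x
    exact ⟨x', by simp, hx'⟩
  | succ n ih =>
    intro x hx
    rw [pow_succ] at hx
    induction hx using Submodule.mul_induction_on' with
    | mem_mul_mem x hx y hy =>
      obtain ⟨x', hx', hx⟩ := ih hx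
      obtain ⟨y', hy', hy⟩ := exists_lifts_of_mem_fundamentalIdeal hy
      exact ⟨x' * y', by rw [pow_succ]; exact Ideal.mul_mem_mul hx' hy', hx.mul hy⟩
    | add x _ y _ hx hy =>
      obtain ⟨x', hx', hx⟩ := hx
      obtain ⟨y', hy', hy⟩ := hy
      exact ⟨x' + y', add_mem hx' hy', hx.add hy⟩

end WittRing

namespace QuadSpace

theorem wittClass_eq_of_isometric {R : Type u} [CommRing R] {V W : QuadSpace R}
    (h : V.Isometric W) : V.wittClass = W.wittClass :=
  congrArg (AddCon.toQuotient (c := wittCon R)) (isoClass_eq_iff.2 h)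

/-- A Witt class in `Iⁿ W_q` over the residue field contains a space having a lift with polar form
in `Iⁿ⁺¹`: lift the factors `x ∈ Iⁿ` and `q` of each summand `x q`, and use that the polar form of
any lift of `q` has even rank. -/
theorem exists_isLift_of_wittClass_mem [IsDomain A] [CharZero A]
    (h2 : (2 : A) ∈ IsLocalRing.maximalIdeal A) (n : ℕ)
    {y : QuadWittGroup (IsLocalRing.ResidueField A)}
    (hy : y ∈ WittRing.fundamentalIdeal (IsLocalRing.ResidueField A) ^ n •
      (⊤ : Submodule (WittRing (IsLocalRing.ResidueField A))
        (QuadWittGroup (IsLocalRing.ResidueField A)))) :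
    ∃ (V : QuadSpace A) (W : QuadSpace (IsLocalRing.ResidueField A)), V.IsLift W ∧
      W.wittClass = y ∧ V.polarSpace.wittClass ∈ WittRing.fundamentalIdeal A ^ (n + 1) := by
  induction hy using Submodule.smul_induction_on' with
  | smul x hx y _ =>
    obtain ⟨_, hx', U, U', hU, rfl, rfl⟩ := WittRing.exists_lifts_of_mem_fundamentalIdeal_pow n hx
    obtain ⟨W, rfl⟩ := QuadWittGroup.exists_wittClass_eq y
    obtain ⟨V, hV⟩ := W.exists_isLift
    refine ⟨tensor U V, tensor U' W, hV.tensor hU, rfl, ?_⟩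
    rw [wittClass_polarSpace_tensor, pow_succ]
    exact Ideal.mul_mem_mul hx'
      (BilinSpace.wittClass_mem_fundamentalIdeal (V.even_finrank h2))
  | add x _ y _ hx hy =>
    obtain ⟨V, W, hV, rfl, h⟩ := hx
    obtain ⟨V', W', hV', rfl, h'⟩ := hy
    refine ⟨V.add V', W.add W', hV.add hV', rfl, ?_⟩
    rw [wittClass_polarSpace_add]
    exact add_mem h h'

end QuadSpace

end wittClasses

theorem mainTheorem10 {A : Type u} [CommRing A] [IsDomain A] [IsDiscreteValuationRing A]
    [HenselianLocalRing A] [CharZero A] (hA : IsLocalRing.maximalIdeal A = Ideal.span {2})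
    (n : ℕ) (hn : 1 ≤ n) (ψ : QuadSpace (IsLocalRing.ResidueField A))
    (hψ : ψ.wittClass ∈ WittRing.fundamentalIdeal (IsLocalRing.ResidueField A) ^ n •
      (⊤ : Submodule (WittRing (IsLocalRing.ResidueField A))
        (QuadWittGroup (IsLocalRing.ResidueField A)))) :
    (∃ ψ' : QuadSpace A,
      ψ'.polarSpace.wittClass ∈ WittRing.fundamentalIdeal A ^ (n + 1) ∧
      (ψ'.baseChange (IsLocalRing.ResidueField A)).wittClass = ψ.wittClass) ∧
    (n = 1 → ∃ ψ' : QuadSpace A,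
      ψ'.polarSpace.wittClass ∈ WittRing.fundamentalIdeal A ^ 2 ∧
      (ψ'.baseChange (IsLocalRing.ResidueField A)).Isometric ψ) := by
  obtain ⟨V, W, hV, hW, hI⟩ := QuadSpace.exists_isLift_of_wittClass_mem
    (hA ▸ Ideal.mem_span_singleton_self 2) n hψ
  obtain ⟨ψ', hψ', hclass⟩ := hV.exists_of_wittClass_eq hW
  rw [← hclass] at hI
  have hiso := hψ'.isometric_baseChange
  refine ⟨⟨ψ', hI, QuadSpace.wittClass_eq_of_isometric hiso⟩, ?_⟩
  rintro rfl
  exact ⟨ψ', hI, hiso⟩
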